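/- Let $Q$ be a smooth finite-dimensional manifold with projections $\tau_Q:TQ\to Q$, $\pi_Q:T^*Q\to Q$, and let $L:TQ\to\mathbb R$ be a smooth Lagrangian with vertical endomorphism $S$, Liouville field $\Delta$, $\alpha_L=S^*(dL)$, $\omega_L=-d\alpha_L$, $E_L=\Delta(L)-L$ and Legendre transformation $FL:TQ\to T^*Q$. Assume that $L$ is almost regular: $M_1=FL(TQ)$ is a submanifold of $T^*Q$ and $FL:TQ\to M_1$ is a submersion with connected fibres. Let $\omega_Q=dq^A\wedge dp_A$, let $\omega_1$ be its restriction to $M_1$ and let $h_1:M_1\to\mathbb R$ be given by $h_1\circ FL=E_L$. Let $P_1=TQ$ and $$P_{i+1}=\{z\in P_i:\ \exists\,x\in T_zP_i,\ i_x\omega_L=dE_L(z)\},\qquad M_{i+1}=\{p\in M_i:\ \exists\,x\in T_pM_i,\ i_x\omega_1=dh_1(p)\}$$ be the sets given by the constraint algorithm, and $Q_i=\pi_Q(M_i)$. Assume that the algorithm stabilizes, $P_{f+1}=P_f$, and that for $i\le f$ the sets $P_i,M_i,Q_i$ are submanifolds and $\pi_Q|_{M_i}:M_i\to Q_i$ is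 a submersion. Write $FL_f=FL|_{P_f}:P_f\to M_f$ and $\pi_f=\pi_Q|_{M_f}:M_f\to Q_f$. Let $\xi$ be a smooth vector field on $P_f$ with $i_\xi\omega_L=dE_L$ along $P_f$ which is $FL_f$-projectable onto a smooth vector field $X$ on $M_f$, that is, $TFL(\xi(z))=X(FL(z))$ for $z\in P_f$. Let $\gamma$ be a solution of the Hamilton–Jacobi problem: a smooth closed $1$-form on $Q$ with $\gamma(Q)\subset M_1$, $\gamma(Q_f)\subset M_f$ and $d(h_1\circ\gamma)(q)=0$ for all $q\in Q_f$. Put $\gamma_f=\gamma|_{Q_f}$ and $X^\gamma=T\pi_f\circ X\circ\gamma_f$. For $p\in M_f$ let $\beta_\xi(p)$ be the unique point $z$ of $FL_f^{-1}(p)\subset P_f$ at which $\xi$ is a SODE, i.e. $T\tau_Q(\xi(z))=z$; and for $z\in\mathrm{Im}(\beta_\xi)=\beta_\xi(M_f)$ let $X_\xi(z)$ be the unique vector tangent to $\mathrm{Im}(\beta_\xi)$ at $z$ with $i_{X_\xi(z)}\omega_L=dE_L(z)$ and $T\tau_Q(X_\xi(z))=z$. Then $\beta_\xi$ and $X_\xi$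 are well defined (these points and vectors exist and are unique), $X^\gamma$ is a smooth vector field on $Q_f$, and $$\beta_\xi\circ\gamma_f=X^\gamma$$ as maps $Q_f\to TQ$. Consequently $\beta_\xi\circ\gamma_f:Q_f\to TQ$ is smooth, and $X_\xi$ and $X^\gamma$ are $\beta_\xi\circ\gamma_f$-related: $T(\beta_\xi\circ\gamma_f)(X^\gamma(q))=X_\xi(\beta_\xi(\gamma_f(q)))$ for all $q\in Q_f$. -/

import Mathlib

open Bundle Set Filter
open scoped Manifold Topology ContDiff

noncomputable section

namespace SingularHJ

section General

variable {F : Type*} [NormedAddCommGroup F] [NormedSpace ℝ F]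
  {H : Type*} [TopologicalSpace H] (J : ModelWithCorners ℝ F H)
  {M : Type*} [TopologicalSpace M] [ChartedSpace H M]

/-- `S` is an embedded (regular) submanifold of the manifold without boundary `M`: around each of
its points there is a smooth chart of `M` in which `S` is the trace of a linear subspace.
The dimension may vary from one connected component of `S` to another. -/
def IsSubmanifold (S : Set M) : Prop :=
  ∀ p ∈ S, ∃ φ ∈ IsManifold.maximalAtlas J ∞ M, p ∈ φ.source ∧
    ∃ K : Submodule ℝ F, ∀ x ∈ φ.source, x ∈ S ↔ φ.extend J x ∈ K

/-- The tangent space `T_p S ⊆ T_p M` of a submanifold `S`: the velocities at time `0` of the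
smooth curves of `M` that start at `p` and stay in `S`. -/
def tangentSet (S : Set M) (p : M) : Set (TangentSpace J p) :=
  {v | ∃ c : ℝ → M, ContMDiffAt 𝓘(ℝ, ℝ) J ∞ c 0 ∧ (∀ᶠ t in 𝓝 (0 : ℝ), c t ∈ S) ∧
    tangentMap 𝓘(ℝ, ℝ) J c ⟨0, (1 : ℝ)⟩ = ⟨p, v⟩}

/-- `X` restricts to a smooth vector field on the submanifold `S`
(the values of `X` outside `S` play no role). -/
def IsVectorFieldOn [IsManifold J 1 M] (S : Set M) (X : ∀ p : M, TangentSpace J p) : Prop :=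
  (∀ p ∈ S, X p ∈ tangentSet J S p) ∧
    ContMDiffOn J J.tangent ∞ (fun p => (⟨p, X p⟩ : TangentBundle J M)) S

/-- A one-form on `M`. -/
abbrev OneForm (M : Type*) [TopologicalSpace M] [ChartedSpace H M] : Type _ :=
  ∀ p : M, TangentSpace J p →L[ℝ] ℝ

/-- The local expression of a one-form in the preferred chart around `p`. -/
def OneForm.inChart (α : OneForm J M) (p : M) (y : F) : F →L[ℝ] ℝ :=
  (α ((extChartAt J p).symm y)).comp (mfderiv 𝓘(ℝ, F) J (extChartAt J p).symm y)

/-- The exterior derivative of a one-form on a manifold without boundary, computed in the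
preferred chart around `p`, with `dα(u, v) = u(α(v)) - v(α(u))` for constant `u`, `v`. -/
def OneForm.d (α : OneForm J M) (p : M) (u v : TangentSpace J p) : ℝ :=
  let T : TangentSpace J p →L[ℝ] F := mfderiv J 𝓘(ℝ, F) (extChartAt J p) p
  let D : F →L[ℝ] F →L[ℝ] ℝ := fderiv ℝ (OneForm.inChart J α p) (extChartAt J p p)
  D (T u) (T v) - D (T v) (T u)

/-- `i_v Ω = dh` at `p`, as an identity of covectors on `T_p S`, for a function `h` on the
submanifold `S`. On `T_p S` the map `mfderivWithin J 𝓘(ℝ, ℝ) h S p` is the differential of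
`h : S → ℝ`. -/
def SolvesAt (S : Set M) (Ω : ∀ p : M, TangentSpace J p → TangentSpace J p → ℝ) (h : M → ℝ)
    (p : M) (v : TangentSpace J p) : Prop :=
  ∀ w ∈ tangentSet J S p, Ω p v w = mfderivWithin J 𝓘(ℝ, ℝ) h S p w

/-- The constraint algorithm for the presymplectic system `(S, Ω|_S, dh)`, where `S` is a
submanifold of `M`: the step with index `0` is `S`, and the next step consists of the points `p` of
the present one, `C`, at which `i_v Ω = dh` on `T_p S` has a solution `v ∈ T_p C`. -/
def constraintSet (S : Set M) (Ω : ∀ p : M, TangentSpace J p → TangentSpace J p → ℝ)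
    (h : M → ℝ) : ℕ → Set M
  | 0 => S
  | k + 1 => {p | p ∈ constraintSet S Ω h k ∧
      ∃ v ∈ tangentSet J (constraintSet S Ω h k) p, SolvesAt J S Ω h p v}

end General

section Mechanics

variable {E : Type*} [NormedAddCommGroup E] [NormedSpace ℝ E]
  {Q : Type*} [TopologicalSpace Q] [ChartedSpace E Q] [IsManifold 𝓘(ℝ, E) ∞ Q]

/-- The tangent bundle `TQ`. -/
abbrev TB (E : Type*) [NormedAddCommGroup E] [NormedSpace ℝ E]
    (Q : Type*) [TopologicalSpace Q] [ChartedSpace E Q] : Type _ :=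
  TangentBundle 𝓘(ℝ, E) Q

/-- The model with corners of the manifold `TQ`. -/
abbrev TI (E : Type*) [NormedAddCommGroup E] [NormedSpace ℝ E] :
    ModelWithCorners ℝ (E × E) (ModelProd E E) :=
  𝓘(ℝ, E).tangent

/-- The cotangent bundle `T^*Q`, as the bundle of linear maps from `TQ` to the trivial line
bundle. -/
abbrev CB (E : Type*) [NormedAddCommGroup E] [NormedSpace ℝ E]
    (Q : Type*) [TopologicalSpace Q] [ChartedSpace E Q] : Type _ :=
  TotalSpace (E →L[ℝ] ℝ) (fun q : Q => TangentSpace 𝓘(ℝ, E) q →L[ℝ] Bundle.Trivial Q ℝ q)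

/-- The model with corners of the manifold `T^*Q`. -/
abbrev CI (E : Type*) [NormedAddCommGroup E] [NormedSpace ℝ E] :
    ModelWithCorners ℝ (E × (E →L[ℝ] ℝ)) (ModelProd E (E →L[ℝ] ℝ)) :=
  𝓘(ℝ, E).prod 𝓘(ℝ, E →L[ℝ] ℝ)

/-- The projection `τ_Q : TQ → Q`. -/
def tauQ (v : TB E Q) : Q := v.proj

/-- The projection `π_Q : T^*Q → Q`. -/
def piQ (a : CB E Q) : Q := a.proj

/-- The covector `γ(q)` as a point of `T^*Q`: a one-form on `Q` as a section of `π_Q`. -/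
def toCB (γ : OneForm 𝓘(ℝ, E) Q) (q : Q) : CB E Q := ⟨q, γ q⟩

/-- The vertical lift `T_q Q → T_v(TQ)` at `v ∈ T_q Q`: the derivative at `v` of the inclusion of
the fibre `T_q Q` into `TQ`. -/
def vlift (v : TB E Q) : TangentSpace 𝓘(ℝ, E) v.proj →L[ℝ] TangentSpace (TI E) v :=
  mfderiv 𝓘(ℝ, E) (TI E) (fun w : E => (⟨v.proj, w⟩ : TB E Q)) (v.snd : E)

/-- The tangent map `Tτ_Q` at `v`. -/
def TtauQ (v : TB E Q) : TangentSpace (TI E) v →L[ℝ] TangentSpace 𝓘(ℝ, E) v.proj :=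
  mfderiv (TI E) 𝓘(ℝ, E) tauQ v

/-- The tangent map `Tπ_Q` at `a`. -/
def TpiQ (a : CB E Q) : TangentSpace (CI E) a →L[ℝ] TangentSpace 𝓘(ℝ, E) a.proj :=
  mfderiv (CI E) 𝓘(ℝ, E) piQ a

/-- The vertical endomorphism `S` of `T(TQ)`. -/
def vertEndo (v : TB E Q) : TangentSpace (TI E) v →L[ℝ] TangentSpace (TI E) v :=
  (vlift v).comp (TtauQ v)

/-- The Liouville vector field `Δ` on `TQ`. -/
def liouvilleField (v : TB E Q) : TangentSpace (TI E) v := vlift v v.snd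

/-- The differential of a function on `TQ`. -/
def dTB (f : TB E Q → ℝ) : OneForm (TI E) (TB E Q) :=
  fun v => mfderiv (TI E) 𝓘(ℝ, ℝ) f v

/-- The one-form `α_L = S^*(dL)`. -/
def alphaL (L : TB E Q → ℝ) : OneForm (TI E) (TB E Q) :=
  fun v => (dTB L v).comp (vertEndo v)

/-- The Poincaré-Cartan two-form `ω_L = -dα_L`. -/
def omegaL (L : TB E Q → ℝ) (v : TB E Q) (x y : TangentSpace (TI E) v) : ℝ :=
  - OneForm.d (TI E) (alphaL L) v x y

/-- The energy `E_L = Δ(L) - L`. -/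
def energy (L : TB E Q → ℝ) (v : TB E Q) : ℝ :=
  dTB L v (liouvilleField v) - L v

/-- The Legendre transformation `FL : TQ → T^*Q`, `⟨FL(v), w⟩ = dL(w^V)` with `w^V` the vertical
lift of `w` at `v`; equivalently `⟨FL(v), w⟩ = ⟨α_L(v), W⟩` for each `W` with `Tτ_Q(W) = w`. -/
def legendre (L : TB E Q → ℝ) (v : TB E Q) : CB E Q :=
  ⟨v.proj, (dTB L v).comp (vlift v)⟩

/-- The tangent map `TFL` at `v`. -/
def Tlegendre (L : TB E Q → ℝ) (v : TB E Q) :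
    TangentSpace (TI E) v →L[ℝ] TangentSpace (CI E) (legendre L v) :=
  mfderiv (TI E) (CI E) (legendre L) v

/-- The Liouville one-form on `T^*Q`. -/
def liouvilleForm : OneForm (CI E) (CB E Q) :=
  fun a => ContinuousLinearMap.comp (a.snd : TangentSpace 𝓘(ℝ, E) a.proj →L[ℝ] ℝ) (TpiQ a)

/-- The canonical symplectic form `ω_Q = dq^A ∧ dp_A` of `T^*Q`. -/
def omegaQ (a : CB E Q) (x y : TangentSpace (CI E) a) : ℝ :=
  - OneForm.d (CI E) liouvilleForm a x y

/-- The set `M_1 = FL(TQ)` of primary constraints. -/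
def primarySet (L : TB E Q → ℝ) : Set (CB E Q) := range (legendre L)

/-- The smooth Lagrangian `L` is almost regular: `M_1 = FL(TQ)` is a submanifold of `T^*Q`, and
`FL_1 : TQ → M_1` is a submersion with connected fibres. -/
structure AlmostRegular (L : TB E Q → ℝ) : Prop where
  smooth : ContMDiff (TI E) 𝓘(ℝ, ℝ) ∞ L
  submanifold : IsSubmanifold (CI E) (primarySet L)
  submersion : ∀ v : TB E Q, ∀ y ∈ tangentSet (CI E) (primarySet L) (legendre L v),
    ∃ x, Tlegendre L v x = y
  connected : ∀ a ∈ primarySet L, IsConnected (legendre L ⁻¹' {a})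

open Classical in
/-- The function `h_1` on `M_1` with `h_1 ∘ FL = E_L` (and `0` outside `M_1`); for an almost
regular `L` the energy is constant on the fibres of `FL`, so that any point of the fibre may be
used. -/
def primaryHamiltonian (L : TB E Q → ℝ) (a : CB E Q) : ℝ :=
  if h : ∃ v : TB E Q, legendre L v = a then energy L h.choose else 0

/-- The constraint sets `P_1 = TQ, P_2, P_3, …` of `(TQ, ω_L, dE_L)`; index `0` is `P_1`. -/
def setP (L : TB E Q → ℝ) (k : ℕ) : Set (TB E Q) :=
  constraintSet (TI E) univ (omegaL L) (energy L) k

/-- The constraint sets `M_1, M_2, M_3, …` of `(M_1, ω_1, dh_1)`, where `ω_1` is the restriction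
of `ω_Q` to `M_1`; index `0` is `M_1`. -/
def setM (L : TB E Q → ℝ) (k : ℕ) : Set (CB E Q) :=
  constraintSet (CI E) (primarySet L) omegaQ (primaryHamiltonian L) k

/-- The sets `Q_k = π_Q(M_k)`, with the same shift of the index. -/
def setQ (L : TB E Q → ℝ) (k : ℕ) : Set Q := piQ '' setM L k

/-- The standing assumptions on the step with index `k` of the two algorithms: `P_k`, `M_k` and
`Q_k` are submanifolds, and `π_k : M_k → Q_k` is a submersion. -/
structure RegularStep (L : TB E Q → ℝ) (k : ℕ) : Prop where
  submanifoldP : IsSubmanifold (TI E) (setP L k)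
  submanifoldM : IsSubmanifold (CI E) (setM L k)
  submanifoldQ : IsSubmanifold 𝓘(ℝ, E) (setQ L k)
  submersion : ∀ a ∈ setM L k, ∀ u ∈ tangentSet 𝓘(ℝ, E) (setQ L k) a.proj,
    ∃ x ∈ tangentSet (CI E) (setM L k) a, TpiQ a x = u

/-- The one-form `γ` on `Q` solves the Hamilton-Jacobi problem on `M_f = M_k`: it is smooth and
closed, `γ(Q) ⊆ M_1`, `γ(Q_f) ⊆ M_f`, and `d(h_1 ∘ γ)` vanishes at the points of `Q_f`. -/
structure IsHJSolution (L : TB E Q → ℝ) (k : ℕ) (γ : OneForm 𝓘(ℝ, E) Q) : Prop where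
  smooth : ContMDiff 𝓘(ℝ, E) (CI E) ∞ (toCB γ)
  closed : ∀ (q : Q) (u v : TangentSpace 𝓘(ℝ, E) q), OneForm.d 𝓘(ℝ, E) γ q u v = 0
  mem_primary : ∀ q, toCB γ q ∈ primarySet L
  mem_final : ∀ q ∈ setQ L k, toCB γ q ∈ setM L k
  hamiltonJacobi : ∀ q ∈ setQ L k, ∀ u : TangentSpace 𝓘(ℝ, E) q,
    mfderiv 𝓘(ℝ, E) 𝓘(ℝ, ℝ) (fun q => primaryHamiltonian L (toCB γ q)) q u = 0

/-- `x ∈ T_v(TQ)` satisfies the second order condition `Tτ_Q(x) = τ_{TQ}(x)`. -/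
def IsSODEAt (v : TB E Q) (x : TangentSpace (TI E) v) : Prop := TtauQ v x = v.snd

/-- `v` is the point of `P_f = P_k` in the fibre of `FL` over `a` at which `ξ` is a SODE. -/
def IsSODEPoint (L : TB E Q → ℝ) (k : ℕ) (ξ : ∀ v : TB E Q, TangentSpace (TI E) v)
    (a : CB E Q) (v : TB E Q) : Prop :=
  v ∈ setP L k ∧ legendre L v = a ∧ IsSODEAt v (ξ v)

open Classical in
/-- The Gotay-Nester section `β_ξ : M_f → P_f`: it sends `a` to the point of `FL_f⁻¹(a)` at which
`ξ` is a SODE (and to the zero vector over `π_Q(a)` if there is none). -/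
def beta (L : TB E Q → ℝ) (k : ℕ) (ξ : ∀ v : TB E Q, TangentSpace (TI E) v)
    (a : CB E Q) : TB E Q :=
  if h : ∃ v, IsSODEPoint L k ξ a v then h.choose else ⟨a.proj, 0⟩

/-- The image `Im(β_ξ) ⊆ TQ` of `β_ξ : M_f → P_f`. -/
def imBeta (L : TB E Q → ℝ) (k : ℕ) (ξ : ∀ v : TB E Q, TangentSpace (TI E) v) :
    Set (TB E Q) :=
  beta L k ξ '' setM L k

/-- `x` is tangent to `Im(β_ξ)` at `v` and satisfies `i_x ω_L = dE_L` and the second order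
condition. -/
def IsSODESolutionAt (L : TB E Q → ℝ) (k : ℕ) (ξ : ∀ v : TB E Q, TangentSpace (TI E) v)
    (v : TB E Q) (x : TangentSpace (TI E) v) : Prop :=
  x ∈ tangentSet (TI E) (imBeta L k ξ) v ∧
    (∀ y : TangentSpace (TI E) v, omegaL L v x y = dTB (energy L) v y) ∧ IsSODEAt v x

open Classical in
/-- The vector field `X_ξ` on `Im(β_ξ)`: the one that satisfies `i_{X_ξ} ω_L = dE_L` and the
second order condition (and `0` where there is none). -/
def fieldXi (L : TB E Q → ℝ) (k : ℕ) (ξ : ∀ v : TB E Q, TangentSpace (TI E) v)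
    (v : TB E Q) : TangentSpace (TI E) v :=
  if h : ∃ x, IsSODESolutionAt L k ξ v x then h.choose else 0

/-- The vector field `X^γ = Tπ_f ∘ X ∘ γ_f` on `Q_f`. -/
def fieldGamma (X : ∀ a : CB E Q, TangentSpace (CI E) a) (γ : OneForm 𝓘(ℝ, E) Q) (q : Q) :
    TangentSpace 𝓘(ℝ, E) q :=
  TpiQ (toCB γ q) (X (toCB γ q))

end Mechanics

end SingularHJ

end

/-! The heart of the matter is the formula `β_ξ = Tπ_Q ∘ X` on `M_f`. If `ξ` is a SODE at a point
`v` over `a`, then `v = Tτ_Q(ξ(v)) = Tπ_Q(TFL(ξ(v))) = Tπ_Q(X(a))`, because `τ_Q = π_Q ∘ FL`; this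
gives uniqueness (`IsSODEPoint.eq_projField`). Existence means that `v₀ = Tπ_Q(X(a))` lies in the
fibre of `FL` over `a`. Testing `i_ξ ω_L = dE_L` on vertical vectors shows that at each point `w` of
that fibre the vertical vector `v₀ - w` is killed by `TFL`, so there is a curve in the fibre leaving
`w` towards `v₀`. At a point of the closed fibre nearest to `v₀` this is possible only if that point
is `v₀` (`AlmostRegular.legendre_eq_of_radial`). The argument needs the equation on the whole fibre,
which holds because `P_i = FL⁻¹(M_i)` (`AlmostRegular.setP_eq`). Composing with `γ_f` gives `β_ξ ∘
γ_f = X^γ` and its smoothness.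

The field `X_ξ` is `Tβ_ξ(X)`. Since `FL ∘ β_ξ = id`, its image under `TFL` is `X`, and both the
dynamical equation and the SODE condition see a vector only through `TFL`. Two solutions differ by a
vertical vector in the kernel of `ω_L`, hence by an element of `ker TFL`, while vectors tangent to
`Im(β_ξ)` are determined by their image under `TFL`.

For relatedness, `T(β_ξ ∘ γ_f)(X^γ)` is shown to satisfy the conditions characterizing `X_ξ`. Its
image under `TFL` is `Tγ(X^γ)`, and `omegaQ_HJ` supplies the dynamical equation: closedness makes
`γ(Q)` isotropic, and the Hamilton-Jacobi equation says that `dh_1` vanishes on `Tγ`, so `Tγ(X^γ) -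
X` is a vertical vector annihilating `TM_1` under `ω_Q`.

All of this rests on local sections of a submersion onto a submanifold
(`IsSubmersionInto.exists_local_section`), which lift curves and let functions descend. -/

noncomputable section

namespace SingularHJ

/-! ### Curves and their velocities. -/

section General

variable {F : Type*} [NormedAddCommGroup F] [NormedSpace ℝ F]
  {H : Type*} [TopologicalSpace H] {J : ModelWithCorners ℝ F H}
  {M : Type*} [TopologicalSpace M] [ChartedSpace H M]
  {F' : Type*} [NormedAddCommGroup F'] [NormedSpace ℝ F']
  {H' : Type*} [TopologicalSpace H'] {J' : ModelWithCorners ℝ F' H'}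
  {N : Type*} [TopologicalSpace N] [ChartedSpace H' N]

/-- `c` is a smooth curve through `p` with velocity `v`, at time `0`. -/
structure IsCurve (J : ModelWithCorners ℝ F H) (c : ℝ → M) (p : M) (v : TangentSpace J p) :
    Prop where
  smooth : ContMDiffAt 𝓘(ℝ, ℝ) J ∞ c 0
  eq : c 0 = p
  velocity : (mfderiv 𝓘(ℝ, ℝ) J c 0 (1 : ℝ) : F) = v

/-- An equality in the tangent bundle splits into base point and velocity; tangent spaces being
copies of the model space, the two can then be handled separately. -/
theorem mem_tangentSet_iff {S : Set M} {p : M} {v : TangentSpace J p} :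
    v ∈ tangentSet J S p ↔ ∃ c : ℝ → M, IsCurve J c p v ∧ ∀ᶠ t in 𝓝 (0 : ℝ), c t ∈ S := by
  constructor
  · rintro ⟨c, hc, hS, h⟩
    have h0 : c 0 = p := congrArg TotalSpace.proj h
    subst h0
    refine ⟨c, ⟨hc, rfl, ?_⟩, hS⟩
    have := (TotalSpace.mk_inj).1 h
    exact this
  · rintro ⟨c, ⟨hc, h0, hv⟩, hS⟩
    subst h0
    refine ⟨c, hc, hS, ?_⟩
    exact (TotalSpace.mk_inj).2 hv

/-- The image of a curve under a map differentiable within a set containing the curve. -/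
theorem IsCurve.comp_within {c : ℝ → M} {p : M} {v : TangentSpace J p} (h : IsCurve J c p v)
    {S : Set M} (hS : ∀ᶠ t in 𝓝 (0 : ℝ), c t ∈ S) {g : M → N}
    (hg : ContMDiffWithinAt J J' ∞ g S p) {D : TangentSpace J p →L[ℝ] TangentSpace J' (g p)}
    (hD : HasMFDerivWithinAt J J' g S p D) :
    IsCurve J' (g ∘ c) (g p) (D v) := by
  obtain ⟨hc, rfl, hv⟩ := h
  subst hv
  have h1 := (hc.mdifferentiableAt (by simp)).hasMFDerivAt
  refine ⟨?_, rfl, ?_⟩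
  · have : ContMDiffWithinAt 𝓘(ℝ, ℝ) J' ∞ (g ∘ c) (c ⁻¹' S) 0 :=
      hg.comp 0 (hc.contMDiffWithinAt) (fun _ h => h)
    exact this.contMDiffAt hS
  · have h2 := (hD.comp 0 (h1.hasMFDerivWithinAt (s := c ⁻¹' S)) (fun _ h => h)).hasMFDerivAt hS
    rw [h2.mfderiv]
    rfl

theorem IsCurve.comp {c : ℝ → M} {p : M} {v : TangentSpace J p} (h : IsCurve J c p v)
    {g : M → N} (hg : ContMDiffAt J J' ∞ g p) :
    IsCurve J' (g ∘ c) (g p) (mfderiv J J' g p v) :=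
  h.comp_within (S := univ) (by simp) hg.contMDiffWithinAt
    (hg.mdifferentiableAt (by simp)).hasMFDerivAt.hasMFDerivWithinAt

theorem IsCurve.congr {c c' : ℝ → M} {p : M} {v : TangentSpace J p} (h : IsCurve J c p v)
    (hc : c' =ᶠ[𝓝 0] c) : IsCurve J c' p v := by
  obtain ⟨h1, h2, h3⟩ := h
  exact ⟨h1.congr_of_eventuallyEq hc, hc.eq_of_nhds.trans h2, by rw [hc.mfderiv_eq]; exact h3⟩

theorem IsCurve.of_eq {c : ℝ → M} {p p' : M} {v : TangentSpace J p} (h : IsCurve J c p v)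
    (e : p = p') : IsCurve J c p' (v : F) := by
  subst e
  exact h

theorem IsCurve.velocity_unique {c : ℝ → M} {p : M} {v v' : TangentSpace J p}
    (h : IsCurve J c p v) (h' : IsCurve J c p v') : v = v' :=
  h.velocity.symm.trans h'.velocity

theorem isCurve_const (p : M) : IsCurve J (fun _ : ℝ => p) p 0 :=
  ⟨contMDiffAt_const, rfl, by rw [mfderiv_const]; rfl⟩

theorem isCurve_line (p v : F) : IsCurve 𝓘(ℝ, F) (fun t : ℝ => p + t • v) p v := by
  have h : HasFDerivAt (fun t : ℝ => p + t • v) (ContinuousLinearMap.toSpanSingleton ℝ v) 0 := by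
    have := ((hasDerivAt_id (0 : ℝ)).smul_const v).const_add p
    simpa using this.hasFDerivAt
  refine ⟨?_, by simp, ?_⟩
  · rw [contMDiffAt_iff_contDiffAt]; fun_prop
  · rw [mfderiv_eq_fderiv, h.fderiv]; exact one_smul ℝ v

theorem IsCurve.prodMk {c : ℝ → M} {p : M} {v : TangentSpace J p} (h : IsCurve J c p v)
    {c' : ℝ → N} {p' : N} {v' : TangentSpace J' p'} (h' : IsCurve J' c' p' v') :
    IsCurve (J.prod J') (fun t => (c t, c' t)) (p, p') ((v, v') : F × F') := by
  obtain ⟨hc, rfl, rfl⟩ := h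
  obtain ⟨hc', rfl, rfl⟩ := h'
  refine ⟨hc.prodMk hc', rfl, ?_⟩
  rw [mfderiv_prodMk (hc.mdifferentiableAt (by simp)) (hc'.mdifferentiableAt (by simp))]
  rfl

/-- The curve is a straight line in the preferred chart; without boundary, the chart's target is a
neighbourhood of the starting point. -/
theorem exists_isCurve [J.Boundaryless] [IsManifold J ∞ M] {p : M} (v : TangentSpace J p) :
    ∃ c : ℝ → M, IsCurve J c p v := by
  set φ := extChartAt J p with hφ
  have h1 : ContMDiffAt 𝓘(ℝ, F) J ∞ φ.symm (φ p) :=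
    (contMDiffOn_extChartAt_symm p).contMDiffAt (extChartAt_target_mem_nhds p)
  have h0 : ContMDiffAt J 𝓘(ℝ, F) ∞ φ p := contMDiffAt_extChartAt
  have h2 := ((isCurve_line (φ p) (mfderiv J 𝓘(ℝ, F) φ p v : F)).comp h1).of_eq
    (extChartAt_to_inv p)
  refine ⟨_, h2.smooth, h2.eq, h2.velocity.trans ?_⟩
  have h3 : (mfderiv 𝓘(ℝ, F) J φ.symm (φ p)).comp (mfderiv J 𝓘(ℝ, F) φ p) =
      mfderiv J J (φ.symm ∘ φ) p :=
    (mfderiv_comp p (h1.mdifferentiableAt (by simp)) (h0.mdifferentiableAt (by simp))).symm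
  have h4 : φ.symm ∘ φ =ᶠ[𝓝 p] id := by
    filter_upwards [extChartAt_source_mem_nhds (I := J) p] with w hw using φ.left_inv hw
  have h5 : mfderiv J J (φ.symm ∘ φ) p = ContinuousLinearMap.id ℝ F := by
    rw [h4.mfderiv_eq]; exact mfderiv_id
  rw [h5] at h3
  exact DFunLike.congr_fun h3 v

theorem image_mem_tangentSet {S : Set M} {S' : Set N} {p : M} {v : TangentSpace J p}
    (hv : v ∈ tangentSet J S p) {g : M → N} (hg : ContMDiffAt J J' ∞ g p)
    (hS : MapsTo g S S') : mfderiv J J' g p v ∈ tangentSet J' S' (g p) := by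
  obtain ⟨c, hc, hcS⟩ := mem_tangentSet_iff.1 hv
  exact mem_tangentSet_iff.2 ⟨_, hc.comp hg, hcS.mono fun _ h => hS h⟩

/-! ### Local sections of submersions and lifting of curves. -/

/-- With `s` a right inverse of the derivative, the equation `f (w + s k) = y` has derivative `id`
in `k`, so the implicit function theorem solves it by `k = κ(y, w)`, and `R(y, w) = w + s (κ(y,
w))`. Uniqueness of the solution gives `κ(f w, w) = 0`. Keeping `w` as a parameter makes `R` a
family of sections passing through all nearby points. -/
theorem exists_local_section_of_surjective [CompleteSpace F] [FiniteDimensional ℝ F']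
    {f : F → F'} {z : F}
    (hf : ContDiffAt ℝ ∞ f z) (hsurj : Function.Surjective (fderiv ℝ f z)) :
    ∃ R : F' × F → F, ContDiffAt ℝ ∞ R (f z, z) ∧ (∀ᶠ w in 𝓝 z, R (f w, w) = w) ∧
      ∀ᶠ p in 𝓝 (f z, z), f (R p) = p.1 := by
  have := FiniteDimensional.complete ℝ F'
  obtain ⟨s, hs⟩ := (fderiv ℝ f z).exists_rightInverse_of_surjective (LinearMap.range_eq_top.2 hsurj)
  set G : (F' × F) × F' → F' := fun u => f (u.1.2 + s u.2) - u.1.1 with hG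
  have hGs : ContDiffAt ℝ ∞ G ((f z, z), 0) := by
    have h1 : ContDiffAt ℝ ∞ f ((fun u : (F' × F) × F' => u.1.2 + s u.2) ((f z, z), 0)) := by
      simpa using hf
    have h2 : ContDiffAt ℝ ∞ (fun u : (F' × F) × F' => u.1.2 + s u.2) ((f z, z), 0) := by
      fun_prop
    exact (h1.comp ((f z, z), (0 : F')) h2).sub (by fun_prop)
  have hinv : fderiv ℝ G ((f z, z), 0) ∘L .inr ℝ (F' × F) F' = .id ℝ F' := by
    have h0 : HasFDerivAt (fun k : F' => (((f z, z), k) : (F' × F) × F'))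
        (.inr ℝ (F' × F) F') 0 := hasFDerivAt_prodMk_right _ _
    have h1 := (hGs.differentiableAt (by simp)).hasFDerivAt.comp (0 : F') h0
    have h2 : HasFDerivAt (fun k : F' => f (z + s k) - f z) (fderiv ℝ f z ∘L s) 0 := by
      have h3 : HasFDerivAt f (fderiv ℝ f z) (z + s 0) := by
        simpa using (hf.differentiableAt (by simp)).hasFDerivAt
      exact (h3.comp (0 : F') (s.hasFDerivAt.const_add z)).sub_const _
    rw [hs] at h2
    exact h1.unique h2
  have hI : (fderiv ℝ G ((f z, z), 0) ∘L .inr ℝ (F' × F) F').IsInvertible := by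
    rw [hinv]; exact ⟨.refl ℝ F', rfl⟩
  have hn : (∞ : ℕ∞ω) ≠ 0 := by simp
  set κ := hGs.implicitFunction hn hI with hκ
  have hκ0 : κ (f z, z) = 0 := hGs.implicitFunction_apply_self hn hI
  have hκs : ContDiffAt ℝ ∞ κ (f z, z) := hGs.contDiffAt_implicitFunction hn hI
  have hG0 : G ((f z, z), 0) = 0 := by simp [hG]
  refine ⟨fun p => p.2 + s (κ p), ?_, ?_, ?_⟩
  · exact contDiffAt_snd.add (s.contDiff.contDiffAt.comp _ hκs)
  · have h1 := hGs.eventually_apply_eq_iff_implicitFunction hn hI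
    have h2 : Tendsto (fun w => (((f w, w), 0) : (F' × F) × F')) (𝓝 z) (𝓝 ((f z, z), 0)) :=
      ((hf.continuousAt.prodMk continuousAt_id).prodMk continuousAt_const)
    filter_upwards [h2.eventually h1] with w hw
    have : κ (f w, w) = 0 := hw.1 (by simp [hG])
    simp [this]
  · filter_upwards [hGs.eventually_apply_implicitFunction hn hI] with p hp
    rw [hG0] at hp
    exact sub_eq_zero.1 hp

/-- `f` is a smooth map whose image lies in the submanifold `S`, and it is a submersion
as a map to `S`. -/
structure IsSubmersionInto (J : ModelWithCorners ℝ F H) (J' : ModelWithCorners ℝ F' H')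
    (f : M → N) (S : Set N) : Prop where
  smooth : ContMDiff J J' ∞ f
  submanifold : IsSubmanifold J' S
  mem : ∀ x, f x ∈ S
  surj : ∀ x, ∀ y ∈ tangentSet J' S (f x), ∃ u, mfderiv J J' f x u = y

/-- A chart `ψ` flattens `S` to a subspace `K`. Composing with a linear projection `pr` onto `K`
turns `f` into a map between vector spaces with surjective derivative, to which the linear-model
case applies. -/
theorem IsSubmersionInto.exists_local_section [J.Boundaryless] [J'.Boundaryless]
    [IsManifold J ∞ M] [CompleteSpace F] [FiniteDimensional ℝ F']
    {f : M → N} {S : Set N} (hf : IsSubmersionInto J J' f S) (x : M) :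
    ∃ R : N × M → M, ContMDiffAt (J'.prod J) J ∞ R (f x, x) ∧
      (∀ᶠ w in 𝓝 x, R (f w, w) = w) ∧ ∀ᶠ p in 𝓝 (f x, x), p.1 ∈ S → f (R p) = p.1 := by
  obtain ⟨ψ, hψ, hxψ, K, hK⟩ := hf.submanifold (f x) (hf.mem x)
  obtain ⟨pr, hpr⟩ := Submodule.ClosedComplemented.of_finiteDimensional_quotient
    (p := K) K.closed_of_finiteDimensional
  set φ := extChartAt J x with hφ
  have hψs : ContMDiffAt J' 𝓘(ℝ, F') ∞ (ψ.extend J') (f x) := ψ.contMDiffAt_extend hψ hxψ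
  have hφs : ContMDiffAt J 𝓘(ℝ, F) ∞ φ x := contMDiffAt_extChartAt
  have hφsymm : ContMDiffAt 𝓘(ℝ, F) J ∞ φ.symm (φ x) :=
    (contMDiffOn_extChartAt_symm x).contMDiffAt (extChartAt_target_mem_nhds x)
  have hφx : φ.symm (φ x) = x := extChartAt_to_inv x
  have hprs : ContMDiff 𝓘(ℝ, F') 𝓘(ℝ, K) ∞ pr := pr.contMDiff
  set h : M → K := fun w => pr (ψ.extend J' (f w)) with hh
  have hhs : ContMDiffAt J 𝓘(ℝ, K) ∞ h x :=
    hprs.contMDiffAt.comp x (hψs.comp x hf.smooth.contMDiffAt)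
  set g : F → K := h ∘ φ.symm with hg
  have hgs : ContMDiffAt 𝓘(ℝ, F) 𝓘(ℝ, K) ∞ g (φ x) := by
    refine ContMDiffAt.comp (φ x) (I' := J) ?_ hφsymm
    rwa [hφx]
  have hgφ : ∀ᶠ w in 𝓝 x, g (φ w) = h w := by
    filter_upwards [extChartAt_source_mem_nhds (I := J) x] with w hw
    simp only [hg, Function.comp, φ.left_inv hw]
  -- A direction `k` of `K` is the velocity of a line inside `K`; pulled back by the chart it is a
  -- curve in `S`, so its velocity lies in the image of the derivative of `f`.
  have hsurj : Function.Surjective (fderiv ℝ g (φ x)) := by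
    intro k
    set y₀ : F' := ψ.extend J' (f x) with hy₀
    have hy₀K : y₀ ∈ K := (hK _ hxψ).1 (hf.mem x)
    have hline : IsCurve 𝓘(ℝ, F') (fun t : ℝ => y₀ + t • (k : F')) y₀ (k : F') :=
      isCurve_line _ _
    have htgt : (ψ.extend J').target ∈ 𝓝 y₀ :=
      (ψ.isOpen_extend_target (I := J')).mem_nhds
        ((ψ.extend J').map_source (by rwa [ψ.extend_source]))
    have hψsymm : ContMDiffAt 𝓘(ℝ, F') J' ∞ (ψ.extend J').symm y₀ := by
      refine (contMDiffOn_extend_symm hψ).contMDiffAt ?_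
      rwa [← ψ.extend_target']
    have hc := (hline.comp hψsymm).of_eq (ψ.extend_left_inv hxψ)
    set y : TangentSpace J' (f x) := mfderiv 𝓘(ℝ, F') J' (ψ.extend J').symm y₀ (k : F') with hy
    have hct : ∀ᶠ t in 𝓝 (0 : ℝ), y₀ + t • (k : F') ∈ (ψ.extend J').target := by
      have h1 : Tendsto (fun t : ℝ => y₀ + t • (k : F')) (𝓝 0) (𝓝 y₀) := by
        have : Continuous fun t : ℝ => y₀ + t • (k : F') := by fun_prop
        simpa using this.tendsto 0
      exact h1 htgt
    obtain ⟨u, hu⟩ := hf.surj x y (mem_tangentSet_iff.2 ⟨_, hc, by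
      filter_upwards [hct] with t ht
      have h1 := (ψ.extend J').map_target ht
      rw [ψ.extend_source] at h1
      refine (hK _ h1).2 ?_
      rw [(ψ.extend J').right_inv ht]
      exact K.add_mem hy₀K (K.smul_mem _ k.2)⟩)
    have hprψ : ContMDiffAt J' 𝓘(ℝ, K) ∞ (pr ∘ ψ.extend J') (f x) := hprs.contMDiffAt.comp _ hψs
    have hk1 := hc.comp hprψ
    have hk2 : IsCurve 𝓘(ℝ, K) (fun t : ℝ => (pr y₀ : K) + t • k) (pr y₀) k := isCurve_line _ _
    have hk3 : mfderiv J' 𝓘(ℝ, K) (pr ∘ ψ.extend J') (f x) y = k := by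
      refine hk1.velocity_unique (hk2.congr ?_)
      filter_upwards [hct] with t ht
      simp only [Function.comp_apply, (ψ.extend J').right_inv ht, map_add, map_smul, hpr]
    refine ⟨mfderiv J 𝓘(ℝ, F) φ x u, ?_⟩
    have e1 : mfderiv J 𝓘(ℝ, K) h x = mfderiv J 𝓘(ℝ, K) (g ∘ φ) x :=
      (EventuallyEq.mfderiv_eq hgφ).symm
    have e2 : mfderiv J 𝓘(ℝ, K) (g ∘ φ) x =
        (mfderiv 𝓘(ℝ, F) 𝓘(ℝ, K) g (φ x)).comp (mfderiv J 𝓘(ℝ, F) φ x) :=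
      mfderiv_comp x (hgs.mdifferentiableAt (by simp)) (hφs.mdifferentiableAt (by simp))
    have e3 : mfderiv J 𝓘(ℝ, K) h x =
        (mfderiv J' 𝓘(ℝ, K) (pr ∘ ψ.extend J') (f x)).comp (mfderiv J J' f x) :=
      mfderiv_comp x (g := pr ∘ ψ.extend J') (hprψ.mdifferentiableAt (by simp))
        (hf.smooth.mdifferentiable (by simp) x)
    rw [← mfderiv_eq_fderiv]
    have e4 := DFunLike.congr_fun (e1.symm.trans e3) u
    rw [e2] at e4
    refine e4.trans ?_
    rw [← hk3, ← hu]
    rfl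
  obtain ⟨R, hRs, hR1, hR2⟩ := exists_local_section_of_surjective
    (contMDiffAt_iff_contDiffAt.1 hgs) hsurj
  have hgx : g (φ x) = pr (ψ.extend J' (f x)) := by
    simp only [hg, Function.comp_apply, hφx, hh]
  have hi : ContMDiffAt (J'.prod J) 𝓘(ℝ, K × F) ∞
      (fun p : N × M => (pr (ψ.extend J' p.1), φ p.2)) (f x, x) := by
    refine ContMDiffAt.prodMk_space ?_ ?_
    · exact hprs.contMDiffAt.comp (f x, x) (hψs.comp (f x, x) contMDiffAt_fst)
    · exact hφs.comp (f x, x) contMDiffAt_snd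
  have hix : (pr (ψ.extend J' (f x, x).1), φ (f x, x).2) = (g (φ x), φ x) := by
    simp only [hgx]
  have hRx : R (g (φ x), φ x) = φ x := hR1.self_of_nhds
  have hRi : ContMDiffAt (J'.prod J) 𝓘(ℝ, F) ∞
      (fun p : N × M => R (pr (ψ.extend J' p.1), φ p.2)) (f x, x) := by
    refine ContMDiffAt.comp (f x, x) (I' := 𝓘(ℝ, K × F)) (g := R) ?_ hi
    rw [hix]
    exact contMDiffAt_iff_contDiffAt.2 hRs
  have hRix : R (pr (ψ.extend J' (f x)), φ x) = φ x := by rw [← hgx, hRx]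
  have hRm : ContMDiffAt (J'.prod J) J ∞
      (fun p : N × M => φ.symm (R (pr (ψ.extend J' p.1), φ p.2))) (f x, x) := by
    refine ContMDiffAt.comp (f x, x) (I' := 𝓘(ℝ, F)) (g := φ.symm) ?_ hRi
    simpa only [hRix] using hφsymm
  refine ⟨fun p => φ.symm (R (pr (ψ.extend J' p.1), φ p.2)), hRm, ?_, ?_⟩
  · filter_upwards [hφs.continuousAt.eventually hR1, hgφ,
      extChartAt_source_mem_nhds (I := J) x] with w h1 h2 h3
    rw [h2] at h1
    simp only [hh] at h1
    rw [h1, φ.left_inv h3]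
  · have hfR : ContinuousAt (fun p : N × M => f (φ.symm (R (pr (ψ.extend J' p.1), φ p.2))))
        (f x, x) := hf.smooth.continuous.continuousAt.comp hRm.continuousAt
    have hfRx : f (φ.symm (R (pr (ψ.extend J' (f x)), φ x))) = f x := by rw [hRix, hφx]
    have hsrc : ψ.source ∈ 𝓝 (f x) := ψ.open_source.mem_nhds hxψ
    have i1 : ∀ᶠ p in 𝓝 (f x, x), f (φ.symm (R (pr (ψ.extend J' p.1), φ p.2))) ∈ ψ.source := by
      refine hfR.eventually ?_
      change ψ.source ∈ 𝓝 (f (φ.symm (R (pr (ψ.extend J' (f x)), φ x))))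
      rw [hfRx]
      exact hsrc
    have i2 : ∀ᶠ p : N × M in 𝓝 (f x, x), p.1 ∈ ψ.source :=
      continuousAt_fst.eventually hsrc
    have i3 := hi.continuousAt
    rw [ContinuousAt, hix] at i3
    filter_upwards [i1, i2, i3.eventually hR2] with p h1 h2 h3 hp
    simp only [hg, hh, Function.comp_apply] at h3
    -- Both points lie in `S`, where `pr` acts as the identity on chart values; equality after
    -- projecting is therefore equality.
    have j1 := hpr ⟨_, (hK _ h1).1 (hf.mem _)⟩
    have j2 := hpr ⟨_, (hK _ h2).1 hp⟩
    simp only at j1 j2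
    have h4 : ψ.extend J' (f (φ.symm (R (pr (ψ.extend J' p.1), φ p.2)))) = ψ.extend J' p.1 :=
      congrArg Subtype.val (j1.symm.trans (h3.trans j2))
    exact (ψ.extend J').injOn (by rwa [ψ.extend_source]) (by rwa [ψ.extend_source]) h4

/-- Any curve `b₀` with velocity `u` can be corrected to `R(c t, b₀ t)`. The velocity stays `u`,
since `R(f(b₀ t), b₀ t) = b₀ t` and `c` has the same velocity as `f ∘ b₀`. -/
theorem IsSubmersionInto.exists_curve_lift [J.Boundaryless] [J'.Boundaryless]
    [IsManifold J ∞ M] [IsManifold J' ∞ N] [CompleteSpace F] [FiniteDimensional ℝ F']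
    {f : M → N} {S : Set N} (hf : IsSubmersionInto J J' f S) {x : M} {u : TangentSpace J x}
    {c : ℝ → N} (hc : IsCurve J' c (f x) (mfderiv J J' f x u))
    (hcS : ∀ᶠ t in 𝓝 (0 : ℝ), c t ∈ S) :
    ∃ b : ℝ → M, IsCurve J b x u ∧ ∀ᶠ t in 𝓝 (0 : ℝ), f (b t) = c t := by
  obtain ⟨R, hRs, hR1, hR2⟩ := hf.exists_local_section x
  obtain ⟨b₀, hb₀⟩ := exists_isCurve (J := J) u
  have hR0 : R (f x, x) = x := hR1.self_of_nhds
  have h1 := (hc.prodMk hb₀).comp hRs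
  have h2 := ((hb₀.comp hf.smooth.contMDiffAt).prodMk hb₀).comp hRs
  have hb₀c : Tendsto b₀ (𝓝 0) (𝓝 x) := by
    simpa [hb₀.eq] using hb₀.smooth.continuousAt.tendsto
  have hcc : Tendsto c (𝓝 0) (𝓝 (f x)) := by
    simpa [hc.eq] using hc.smooth.continuousAt.tendsto
  have h3 : mfderiv (J'.prod J) J R (f x, x) ((mfderiv J J' f x u, u) : F' × F) = u := by
    have h4 := (h2.of_eq hR0).congr (c' := b₀)
      (by filter_upwards [hb₀c.eventually hR1] with t ht using ht.symm)
    exact h4.velocity_unique hb₀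
  refine ⟨_, ⟨(h1.of_eq hR0).smooth, (h1.of_eq hR0).eq, (h1.of_eq hR0).velocity.trans h3⟩, ?_⟩
  filter_upwards [(hcc.prodMk_nhds hb₀c).eventually hR2, hcS] with t h1 h2
  exact h1 h2

/-! ### Descent of functions and of the constraint algorithm. -/

/-- A function whose differential vanishes on the vertical vectors of a submersion
is locally constant on the fibres. -/
theorem IsSubmersionInto.eventually_eq [J.Boundaryless] [J'.Boundaryless]
    [IsManifold J ∞ M] [IsManifold J' ∞ N] [CompleteSpace F] [FiniteDimensional ℝ F']
    {f : M → N} {S : Set N} (hf : IsSubmersionInto J J' f S) {e : M → ℝ}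
    (he : ContMDiff J 𝓘(ℝ, ℝ) ∞ e)
    (hker : ∀ x u, mfderiv J J' f x u = 0 → mfderiv J 𝓘(ℝ, ℝ) e x u = 0) (x : M) :
    ∀ᶠ w in 𝓝 x, f w = f x → e w = e x := by
  obtain ⟨R, hRs, hR1, hR2⟩ := hf.exists_local_section x
  set φ := extChartAt J x with hφ
  have hR0 : R (f x, x) = x := hR1.self_of_nhds
  have hφsymm : ContMDiffAt 𝓘(ℝ, F) J ∞ φ.symm (φ x) :=
    (contMDiffOn_extChartAt_symm x).contMDiffAt (extChartAt_target_mem_nhds x)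
  have hφx : φ.symm (φ x) = x := extChartAt_to_inv x
  -- In the chart, `r` retracts a neighbourhood onto the fibre through `x`: it takes values there
  -- and fixes its points. Hence `e ∘ r` has zero derivative and is constant on a ball.
  set r : F → M := fun w => R (f x, φ.symm w) with hr
  have hri : ContMDiffAt 𝓘(ℝ, F) (J'.prod J) ∞ (fun w => (f x, φ.symm w)) (φ x) :=
    contMDiffAt_const.prodMk hφsymm
  have hrs : ContMDiffAt 𝓘(ℝ, F) J ∞ r (φ x) := by
    refine ContMDiffAt.comp (φ x) (I' := J'.prod J) (g := R) ?_ hri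
    rwa [hφx]
  have hri' : Tendsto (fun w => (f x, φ.symm w)) (𝓝 (φ x)) (𝓝 (f x, x)) := by
    have := hri.continuousAt.tendsto
    rwa [hφx] at this
  have hfr : ∀ᶠ w in 𝓝 (φ x), f (r w) = f x := by
    filter_upwards [hri'.eventually hR2] with w hw using hw (hf.mem x)
  have hrd : ∀ᶠ w in 𝓝 (φ x), MDifferentiableAt 𝓘(ℝ, F) J r w := by
    have h1 : ContMDiffAt 𝓘(ℝ, F) J 1 r (φ x) := hrs.of_le (by simp)
    have := (contMDiffAt_iff_contMDiffAt_nhds (n := 1) (by simp)).1 h1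
    filter_upwards [this] with w hw using hw.mdifferentiableAt (by simp)
  have hder : ∀ᶠ w in 𝓝 (φ x), HasFDerivAt (e ∘ r) (0 : F →L[ℝ] ℝ) w := by
    filter_upwards [hrd, hfr.eventually_nhds] with w h1 h2
    have h3 : HasMFDerivAt 𝓘(ℝ, F) 𝓘(ℝ, ℝ) (e ∘ r) w
        ((mfderiv J 𝓘(ℝ, ℝ) e (r w)).comp (mfderiv 𝓘(ℝ, F) J r w)) :=
      (he.mdifferentiable (by simp) (r w)).hasMFDerivAt.comp w h1.hasMFDerivAt
    have h4 : (mfderiv J J' f (r w)).comp (mfderiv 𝓘(ℝ, F) J r w) = 0 := by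
      have h5 : mfderiv 𝓘(ℝ, F) J' (f ∘ r) w = _ :=
        mfderiv_comp w (hf.smooth.mdifferentiable (by simp) (r w)) h1
      rw [← h5]
      have h6 : f ∘ r =ᶠ[𝓝 w] fun _ => f x := h2
      exact h6.mfderiv_eq.trans mfderiv_const
    have h7 : (mfderiv J 𝓘(ℝ, ℝ) e (r w)).comp (mfderiv 𝓘(ℝ, F) J r w) = 0 := by
      ext v
      exact hker _ _ (DFunLike.congr_fun h4 v)
    rw [h7] at h3
    exact h3.hasFDerivAt
  obtain ⟨ε, hε, hball⟩ := Metric.eventually_nhds_iff_ball.1 hder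
  have hconst : ∀ w ∈ Metric.ball (φ x) ε, e (r w) = e (r (φ x)) := by
    intro w hw
    exact (convex_ball (φ x) ε).is_const_of_fderivWithin_eq_zero (𝕜 := ℝ) (f := e ∘ r)
      (fun y hy => (hball y hy).differentiableAt.differentiableWithinAt)
      (fun y hy => by
        rw [fderivWithin_of_isOpen Metric.isOpen_ball hy]; exact (hball y hy).fderiv)
      hw (Metric.mem_ball_self hε)
  have hφc : ContinuousAt φ x := continuousAt_extChartAt x
  filter_upwards [hR1, hφc.eventually (Metric.ball_mem_nhds _ hε),
    extChartAt_source_mem_nhds (I := J) x] with w h1 h2 h3 h4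
  have h5 := hconst _ h2
  simp only [hr] at h5
  rw [φ.left_inv h3, hφx, hR0, ← h4, h1] at h5
  exact h5

theorem IsSubmersionInto.eq_of_fibre [J.Boundaryless] [J'.Boundaryless]
    [IsManifold J ∞ M] [IsManifold J' ∞ N] [CompleteSpace F] [FiniteDimensional ℝ F']
    {f : M → N} {S : Set N} (hf : IsSubmersionInto J J' f S) {e : M → ℝ}
    (he : ContMDiff J 𝓘(ℝ, ℝ) ∞ e)
    (hker : ∀ x u, mfderiv J J' f x u = 0 → mfderiv J 𝓘(ℝ, ℝ) e x u = 0)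
    {a : N} (hconn : IsPreconnected (f ⁻¹' {a})) {x y : M} (hx : f x = a) (hy : f y = a) :
    e x = e y := by
  have := isPreconnected_iff_preconnectedSpace.1 hconn
  have h1 : IsLocallyConstant (fun w : f ⁻¹' {a} => e w) := by
    rw [IsLocallyConstant.iff_eventually_eq]
    intro w
    filter_upwards [continuous_subtype_val.continuousAt.eventually
      (hf.eventually_eq he hker w)] with w' hw'
    exact hw' (w'.2.trans w.2.symm)
  exact h1.apply_eq_of_preconnectedSpace ⟨x, hx⟩ ⟨y, hy⟩

/-- A function constant on the fibres of a submersion descends to a smooth function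
on the image. -/
theorem IsSubmersionInto.contMDiffWithinAt_of_comp [J.Boundaryless] [J'.Boundaryless]
    [IsManifold J ∞ M] [CompleteSpace F] [FiniteDimensional ℝ F']
    {f : M → N} {S : Set N} (hf : IsSubmersionInto J J' f S) {h : N → ℝ}
    (he : ContMDiff J 𝓘(ℝ, ℝ) ∞ (h ∘ f)) (x : M) :
    ContMDiffWithinAt J' 𝓘(ℝ, ℝ) ∞ h S (f x) := by
  obtain ⟨R, hRs, hR1, hR2⟩ := hf.exists_local_section x
  -- With its second argument frozen at `x`, `R` is a local section of `f` over `S`, and `h` is `h ∘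
  -- f` composed with it.
  have hi : ContMDiffAt J' (J'.prod J) ∞ (fun b : N => (b, x)) (f x) :=
    contMDiffAt_id.prodMk contMDiffAt_const
  have h1 : ContMDiffAt J' 𝓘(ℝ, ℝ) ∞ (fun b => h (f (R (b, x)))) (f x) :=
    he.contMDiffAt.comp (f x) (ContMDiffAt.comp (f x) hRs hi)
  refine (h1.contMDiffWithinAt (s := S)).congr_of_eventuallyEq ?_ ?_
  · have := hi.continuousAt.eventually hR2
    filter_upwards [nhdsWithin_le_nhds this, self_mem_nhdsWithin] with b h2 h3
    rw [h2 h3]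
  · have hR0 : R (f x, x) = x := hR1.self_of_nhds
    rw [hR0]

/-- The constraint algorithm commutes with the pullback by a submersion. -/
theorem IsSubmersionInto.constraintSet_eq [J.Boundaryless] [J'.Boundaryless]
    [IsManifold J ∞ M] [IsManifold J' ∞ N] [CompleteSpace F] [FiniteDimensional ℝ F']
    {f : M → N} {S : Set N} (hf : IsSubmersionInto J J' f S)
    {Ω : ∀ p : M, TangentSpace J p → TangentSpace J p → ℝ}
    {Ω' : ∀ p : N, TangentSpace J' p → TangentSpace J' p → ℝ}
    (hΩ : ∀ p u v, Ω p u v = Ω' (f p) (mfderiv J J' f p u) (mfderiv J J' f p v))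
    {h : N → ℝ} (he : ContMDiff J 𝓘(ℝ, ℝ) ∞ (h ∘ f)) (i : ℕ) :
    constraintSet J univ Ω (h ∘ f) i = f ⁻¹' constraintSet J' S Ω' h i := by
  have hdh : ∀ x u, mfderivWithin J' 𝓘(ℝ, ℝ) h S (f x) (mfderiv J J' f x u) =
      mfderiv J 𝓘(ℝ, ℝ) (h ∘ f) x u := by
    intro x u
    have h1 := ((hf.contMDiffWithinAt_of_comp he x).mdifferentiableWithinAt (by simp)).hasMFDerivWithinAt
    have h2 := (hf.smooth.mdifferentiable (by simp) x).hasMFDerivAt.hasMFDerivWithinAt (s := univ)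
    have h3 := (h1.comp x h2 (fun w _ => hf.mem w)).hasMFDerivAt univ_mem
    rw [h3.mfderiv]
    rfl
  have htan : ∀ (i : ℕ), constraintSet J' S Ω' h i ⊆ S := by
    intro i
    induction i with
    | zero => exact subset_rfl
    | succ i ih => exact fun p hp => ih hp.1
  have hsolves : ∀ x u, SolvesAt J univ Ω (h ∘ f) x u ↔
      SolvesAt J' S Ω' h (f x) (mfderiv J J' f x u) := by
    intro x u
    have h0 : ∀ w : TangentSpace J x, w ∈ tangentSet J univ x := fun w =>
      mem_tangentSet_iff.2 ((exists_isCurve w).imp fun c hc => ⟨hc, by simp⟩)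
    constructor
    · intro hu y hy
      obtain ⟨w, rfl⟩ := hf.surj x y hy
      rw [← hΩ, hdh, hu w (h0 w), mfderivWithin_univ]
    · intro hu w _
      rw [mfderivWithin_univ, hΩ, ← hdh]
      exact hu _ (image_mem_tangentSet (h0 w) hf.smooth.contMDiffAt fun w _ => hf.mem w)
  induction i with
  | zero => exact (eq_univ_of_forall hf.mem).symm
  | succ i ih =>
    ext x
    simp only [constraintSet, mem_ofPred_eq, mem_preimage, ih]
    refine and_congr_right fun hx => ?_
    constructor
    · rintro ⟨u, hu, hu'⟩
      exact ⟨_, image_mem_tangentSet hu hf.smooth.contMDiffAt (fun w hw => hw),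
        (hsolves x u).1 hu'⟩
    · rintro ⟨y, hy, hy'⟩
      -- Every vector `u` over `y` is tangent to the preimage: a curve in the downstairs constraint
      -- set lifts with initial velocity `u`, and its lift stays in the preimage.
      obtain ⟨c, hc, hcS⟩ := mem_tangentSet_iff.1 hy
      obtain ⟨u, rfl⟩ := hf.surj x y
        (mem_tangentSet_iff.2 ⟨c, hc, hcS.mono fun _ h => htan i h⟩)
      obtain ⟨b, hb, hbc⟩ := hf.exists_curve_lift hc (hcS.mono fun _ h => htan i h)
      refine ⟨u, mem_tangentSet_iff.2 ⟨b, hb, ?_⟩, (hsolves x u).2 hy'⟩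
      filter_upwards [hbc, hcS] with t h1 h2
      rwa [mem_preimage, h1]

end General

/-! ### The charts of `TQ` and `T^*Q`, and the Legendre transformation in them. -/

section Mechanics

variable {E : Type*} [NormedAddCommGroup E] [NormedSpace ℝ E]
  {Q : Type*} [TopologicalSpace Q] [ChartedSpace E Q]

/-- The tangent vector at `q` with the coordinates `w` in the preferred chart around `q`. -/
def mkTB (q : Q) (w : E) : TB E Q := ⟨q, w⟩

/-- The coordinates of a tangent vector in the preferred chart around its base point. -/
def vec (v : TB E Q) : E := v.snd

@[simp] theorem mkTB_proj (q : Q) (w : E) : (mkTB q w).proj = q := rfl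

/-- The covector of a point of `T^*Q`. -/
def covector (b : CB E Q) : E →L[ℝ] ℝ := b.snd

variable [IsManifold 𝓘(ℝ, E) ∞ Q]

/-- The tangent map of the inverse of the preferred chart around `q`. -/
def chartFrame (q : Q) (x : E) : E →L[ℝ] E :=
  mfderiv 𝓘(ℝ, E) 𝓘(ℝ, E) (extChartAt 𝓘(ℝ, E) q).symm x

theorem symmL_trivializationAt_eq (q : Q) {x : E} (hx : x ∈ (extChartAt 𝓘(ℝ, E) q).target) :
    (trivializationAt E (TangentSpace 𝓘(ℝ, E) : Q → Type _) q).symmL ℝ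
      ((extChartAt 𝓘(ℝ, E) q).symm x) = chartFrame q x := by
  have := IsManifold.of_le (I := 𝓘(ℝ, E)) (M := Q) (m := 1) (n := ∞) (by simp)
  have h1 := (extChartAt 𝓘(ℝ, E) q).map_target hx
  rw [extChartAt_source] at h1
  rw [TangentBundle.symmL_trivializationAt h1, (extChartAt 𝓘(ℝ, E) q).right_inv hx]
  simp only [modelWithCornersSelf_coe, range_id, mfderivWithin_univ]
  rfl

theorem extChartAt_TB_symm (v : TB E Q) {y : E × E}
    (hy : y.1 ∈ (extChartAt 𝓘(ℝ, E) v.proj).target) :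
    (extChartAt (TI E) v).symm y =
      mkTB ((extChartAt 𝓘(ℝ, E) v.proj).symm y.1) (chartFrame v.proj y.1 y.2) := by
  have h1 := (extChartAt 𝓘(ℝ, E) v.proj).map_target hy
  rw [extChartAt_source] at h1
  have h2 : (extChartAt 𝓘(ℝ, E) v.proj).symm y.1 ∈
      (trivializationAt E (TangentSpace 𝓘(ℝ, E) : Q → Type _) v.proj).baseSet := h1
  set e := trivializationAt E (TangentSpace 𝓘(ℝ, E) : Q → Type _) v.proj with he
  have h3 : extChartAt (TI E) v = _ := FiberBundle.extChartAt v
  have h4 : e.symm ((extChartAt 𝓘(ℝ, E) v.proj).symm y.1) y.2 = chartFrame v.proj y.1 y.2 :=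
    (Trivialization.symmL_apply (R := ℝ) e h2 y.2).symm.trans
      (DFunLike.congr_fun (symmL_trivializationAt_eq v.proj hy) y.2)
  have h5 := e.mk_symm h2 y.2
  rw [h4] at h5
  rw [h3]
  exact h5.symm

theorem mem_extChartAt_TB_target (v : TB E Q) (y : E × E) :
    y ∈ (extChartAt (TI E) v).target ↔ y.1 ∈ (extChartAt 𝓘(ℝ, E) v.proj).target := by
  have : (extChartAt (TI E) v).target = _ := FiberBundle.extChartAt_target v
  rw [this]
  simp only [mem_prod, mem_univ, and_true, mem_inter_iff, mem_preimage, and_iff_left_iff_imp]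
  intro h
  have h1 := (extChartAt 𝓘(ℝ, E) v.proj).map_target h
  rwa [extChartAt_source] at h1

theorem extChartAt_TB_mk (v : TB E Q) (w : E) :
    extChartAt (TI E) v (mkTB v.proj w) = (extChartAt 𝓘(ℝ, E) v.proj v.proj, w) := by
  have h1 : extChartAt (TI E) v = _ := FiberBundle.extChartAt v
  rw [h1]
  refine Prod.ext rfl ?_
  exact (tangentBundleCore 𝓘(ℝ, E) Q).coordChange_self (achart E v.proj) v.proj
    (mem_chart_source E v.proj) w

/-- The cotangent chart is the transpose of the tangent one: covectors are pulled back along the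
coordinate frame, trivially on the side of the line bundle. -/
theorem extChartAt_CB (a b : CB E Q) (hb : b.proj ∈ (extChartAt 𝓘(ℝ, E) a.proj).source) :
    extChartAt (CI E) a b = (extChartAt 𝓘(ℝ, E) a.proj b.proj,
      (covector b).comp (chartFrame a.proj (extChartAt 𝓘(ℝ, E) a.proj b.proj))) := by
  have h1 : extChartAt (CI E) a = _ := FiberBundle.extChartAt a
  rw [h1]
  refine Prod.ext rfl ?_
  have h2 := symmL_trivializationAt_eq a.proj ((extChartAt 𝓘(ℝ, E) a.proj).map_source hb)
  rw [(extChartAt 𝓘(ℝ, E) a.proj).left_inv hb] at h2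
  rw [← h2]
  ext w
  have h3 := Trivialization.continuousLinearMapAt_apply_of_mem (R := ℝ)
    (trivializationAt ℝ (Bundle.Trivial Q ℝ) a.proj) (b := b.proj) (mem_univ _)
  exact h3 _

theorem chartFrame_self (q : Q) :
    chartFrame q (extChartAt 𝓘(ℝ, E) q q) = ContinuousLinearMap.id ℝ E := by
  have := IsManifold.of_le (I := 𝓘(ℝ, E)) (M := Q) (m := 1) (n := ∞) (by simp)
  have h := mfderivWithin_range_extChartAt_symm (I := 𝓘(ℝ, E)) (x := q)
  rw [modelWithCornersSelf_coe, range_id, mfderivWithin_univ] at h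
  exact h

theorem extChartAt_TB_self (v : TB E Q) :
    extChartAt (TI E) v v = (extChartAt 𝓘(ℝ, E) v.proj v.proj, vec v) :=
  extChartAt_TB_mk v (vec v)

theorem contMDiffAt_extChartAt_TB_symm (v : TB E Q) {y : E × E}
    (hy : y.1 ∈ (extChartAt 𝓘(ℝ, E) v.proj).target) :
    ContMDiffAt 𝓘(ℝ, E × E) (TI E) ∞ (extChartAt (TI E) v).symm y :=
  (contMDiffOn_extChartAt_symm v).contMDiffAt
    ((isOpen_extChartAt_target v).mem_nhds ((mem_extChartAt_TB_target v y).2 hy))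

theorem fibre_eq (v : TB E Q) : (mkTB v.proj : E → TB E Q) =
    fun w : E => (extChartAt (TI E) v).symm (extChartAt 𝓘(ℝ, E) v.proj v.proj, w) := by
  ext1 w
  rw [extChartAt_TB_symm v (mem_extChartAt_target v.proj), chartFrame_self, extChartAt_to_inv]
  rfl

theorem contMDiff_fibre (q : Q) :
    ContMDiff 𝓘(ℝ, E) (TI E) ∞ (mkTB q : E → TB E Q) := by
  intro w
  have := fibre_eq (mkTB q w : TB E Q)
  rw [mkTB_proj] at this
  rw [this]
  refine ContMDiffAt.comp w (I' := 𝓘(ℝ, E × E))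
    (contMDiffAt_extChartAt_TB_symm _ (mem_extChartAt_target q)) ?_
  exact contMDiffAt_const.prodMk_space contMDiffAt_id

/-- The Lagrangian in the preferred chart around `q`. -/
def chartLagrangian (L : TB E Q → ℝ) (q : Q) (z : E × E) : ℝ :=
  L (mkTB ((extChartAt 𝓘(ℝ, E) q).symm z.1) (chartFrame q z.1 z.2))

/-- The derivative of a function of two variables with respect to the second one. -/
def fibreDeriv (l : E × E → ℝ) (z : E × E) : E →L[ℝ] ℝ :=
  (fderiv ℝ l z).comp (ContinuousLinearMap.inr ℝ E E)

section Smooth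

theorem contDiffAt_chartLagrangian {L : TB E Q → ℝ} (hL : ContMDiff (TI E) 𝓘(ℝ, ℝ) ∞ L)
    (q : Q) {z : E × E} (hz : z.1 ∈ (extChartAt 𝓘(ℝ, E) q).target) :
    ContDiffAt ℝ ∞ (chartLagrangian L q) z := by
  rw [← contMDiffAt_iff_contDiffAt]
  have h1 := hL.contMDiffAt.comp z (contMDiffAt_extChartAt_TB_symm (mkTB q 0 : TB E Q) hz)
  refine h1.congr_of_eventuallyEq ?_
  have h2 : ∀ᶠ y : E × E in 𝓝 z, y.1 ∈ (extChartAt 𝓘(ℝ, E) q).target :=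
    continuousAt_fst.eventually ((isOpen_extChartAt_target q).mem_nhds hz)
  filter_upwards [h2] with y hy
  rw [Function.comp_apply, extChartAt_TB_symm (mkTB q 0) hy]
  rfl

theorem contDiffAt_fibreDeriv {L : TB E Q → ℝ} (hL : ContMDiff (TI E) 𝓘(ℝ, ℝ) ∞ L)
    (q : Q) {z : E × E} (hz : z.1 ∈ (extChartAt 𝓘(ℝ, E) q).target) :
    ContDiffAt ℝ ∞ (fibreDeriv (chartLagrangian L q)) z := by
  have h1 : ContDiffAt ℝ ∞ (fderiv ℝ (chartLagrangian L q)) z :=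
    (contDiffAt_chartLagrangian hL q hz).fderiv_right (by simp)
  exact h1.clm_comp contDiffAt_const

theorem covector_legendre {L : TB E Q → ℝ} (hL : ContMDiff (TI E) 𝓘(ℝ, ℝ) ∞ L) (v : TB E Q) :
    covector (legendre L v) = fderiv ℝ (fun w : E => L (mkTB v.proj w)) (vec v) := by
  have h1 : mfderiv 𝓘(ℝ, E) 𝓘(ℝ, ℝ) (L ∘ (mkTB v.proj : E → TB E Q)) (vec v) = _ :=
    mfderiv_comp (vec v) (hL.mdifferentiable (by simp) _)
    ((contMDiff_fibre v.proj).mdifferentiable (by simp) _)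
  rw [← mfderiv_eq_fderiv]
  exact h1.symm

theorem differentiable_fibre {L : TB E Q → ℝ} (hL : ContMDiff (TI E) 𝓘(ℝ, ℝ) ∞ L) (q : Q) :
    Differentiable ℝ (fun w : E => L (mkTB q w)) := by
  rw [← mdifferentiable_iff_differentiable]
  exact (hL.comp (contMDiff_fibre q)).mdifferentiable (by simp)

/-- On a single fibre the change to chart coordinates is linear, so this is the chain rule for `L`
restricted to that fibre. It yields `p_A = ∂L/∂v^A`. -/
theorem fibreDeriv_chartLagrangian {L : TB E Q → ℝ} (hL : ContMDiff (TI E) 𝓘(ℝ, ℝ) ∞ L)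
    (q : Q) {z : E × E} (hz : z.1 ∈ (extChartAt 𝓘(ℝ, E) q).target) :
    fibreDeriv (chartLagrangian L q) z =
      (covector (legendre L (mkTB ((extChartAt 𝓘(ℝ, E) q).symm z.1) (chartFrame q z.1 z.2)))).comp
        (chartFrame q z.1) := by
  set x := (extChartAt 𝓘(ℝ, E) q).symm z.1 with hx
  have h1 : HasFDerivAt (fun w : E => chartLagrangian L q (z.1, w))
      (fibreDeriv (chartLagrangian L q) z) z.2 :=
    HasFDerivAt.comp (g := chartLagrangian L q) z.2
      ((contDiffAt_chartLagrangian hL q hz).differentiableAt (by simp)).hasFDerivAt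
      (hasFDerivAt_prodMk_right (𝕜 := ℝ) z.1 z.2)
  have h2 : HasFDerivAt (fun w : E => L (mkTB x (chartFrame q z.1 w))) _ z.2 :=
    ((differentiable_fibre hL x) (chartFrame q z.1 z.2)).hasFDerivAt.comp z.2
      (chartFrame q z.1).hasFDerivAt
  rw [covector_legendre hL]
  exact h1.unique h2

theorem extChartAt_legendre {L : TB E Q → ℝ} (hL : ContMDiff (TI E) 𝓘(ℝ, ℝ) ∞ L)
    (v : TB E Q) {z : E × E} (hz : z.1 ∈ (extChartAt 𝓘(ℝ, E) v.proj).target) :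
    extChartAt (CI E) (legendre L v) (legendre L ((extChartAt (TI E) v).symm z)) =
      (z.1, fibreDeriv (chartLagrangian L v.proj) z) := by
  have h1 := (extChartAt 𝓘(ℝ, E) v.proj).map_target hz
  have h2 := (extChartAt 𝓘(ℝ, E) v.proj).right_inv hz
  rw [extChartAt_TB_symm v hz, fibreDeriv_chartLagrangian hL _ hz]
  set w : TB E Q := mkTB ((extChartAt 𝓘(ℝ, E) v.proj).symm z.1) (chartFrame v.proj z.1 z.2) with hw
  have h3 : extChartAt 𝓘(ℝ, E) v.proj (legendre L w).proj = z.1 := h2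
  have h4 := extChartAt_CB (legendre L v) (legendre L w) h1
  have h5 : (legendre L v).proj = v.proj := rfl
  rw [h5, h3] at h4
  exact h4

theorem contMDiff_legendre {L : TB E Q → ℝ} (hL : ContMDiff (TI E) 𝓘(ℝ, ℝ) ∞ L) :
    ContMDiff (TI E) (CI E) ∞ (legendre L) := by
  intro v
  refine contMDiffAt_totalSpace.2 ⟨(Bundle.contMDiff_proj _).contMDiffAt, ?_⟩
  have hz : (extChartAt (TI E) v v).1 ∈ (extChartAt 𝓘(ℝ, E) v.proj).target := by
    rw [extChartAt_TB_self]; exact mem_extChartAt_target _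
  have h1 : ContMDiffAt (TI E) 𝓘(ℝ, E →L[ℝ] ℝ) ∞
      (fibreDeriv (chartLagrangian L v.proj) ∘ extChartAt (TI E) v) v :=
    (contDiffAt_fibreDeriv hL v.proj hz).contMDiffAt.comp v contMDiffAt_extChartAt
  refine h1.congr_of_eventuallyEq ?_
  filter_upwards [extChartAt_source_mem_nhds (I := TI E) v] with w hw
  have h2 := (mem_extChartAt_TB_target v _).1 ((extChartAt (TI E) v).map_source hw)
  have h3 := congrArg Prod.snd (extChartAt_legendre hL v h2)
  rw [(extChartAt (TI E) v).left_inv hw] at h3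
  refine Eq.trans ?_ h3
  have h4 : extChartAt (CI E) (legendre L v) = _ := FiberBundle.extChartAt (legendre L v)
  rw [h4]
  rfl

theorem hasMFDerivAt_legendre {L : TB E Q → ℝ} (hL : ContMDiff (TI E) 𝓘(ℝ, ℝ) ∞ L) (v : TB E Q) :
    HasMFDerivAt (TI E) (CI E) (legendre L) v ((ContinuousLinearMap.fst ℝ E E).prod
      (fderiv ℝ (fibreDeriv (chartLagrangian L v.proj)) (extChartAt (TI E) v v)) :
        E × E →L[ℝ] E × (E →L[ℝ] ℝ)) := by
  have hz : (extChartAt (TI E) v v).1 ∈ (extChartAt 𝓘(ℝ, E) v.proj).target := by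
    rw [extChartAt_TB_self]; exact mem_extChartAt_target _
  refine ⟨(contMDiff_legendre hL).continuous.continuousAt, ?_⟩
  have h1 := (hasFDerivAt_fst (𝕜 := ℝ) (p := extChartAt (TI E) v v)).prodMk
    ((contDiffAt_fibreDeriv hL v.proj hz).differentiableAt (by simp)).hasFDerivAt
  refine HasFDerivAt.hasFDerivWithinAt (h1.congr_of_eventuallyEq ?_)
  filter_upwards [extChartAt_target_mem_nhds (I := TI E) v] with z hz
  exact extChartAt_legendre hL v ((mem_extChartAt_TB_target v z).1 hz)

end Smooth

end Mechanics

/-! ### The forms `ω_L`, `ω_Q` and the energy in coordinates. -/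

section General

variable {F : Type*} [NormedAddCommGroup F] [NormedSpace ℝ F]
  {H : Type*} [TopologicalSpace H] {J : ModelWithCorners ℝ F H}
  {M : Type*} [TopologicalSpace M] [ChartedSpace H M]

/-- Tangent vectors at `p` are expressed in the preferred chart at `p`, whose own derivative there
is the identity. -/
theorem OneForm.d_eq [IsManifold J 1 M] {α : OneForm J M} {p : M} {D : F →L[ℝ] F →L[ℝ] ℝ}
    (h : HasFDerivAt (OneForm.inChart J α p) D (extChartAt J p p)) (u v : F) :
    OneForm.d J α p u v = D u v - D v u := by
  have h1 := mfderiv_extChartAt_self (I := J) (x := p)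
  have h2 := h.fderiv
  unfold OneForm.d
  dsimp only
  rw [h1, h2]
  rfl

end General

section Calculus

variable {A B G : Type*} [NormedAddCommGroup A] [NormedSpace ℝ A] [NormedAddCommGroup B]
  [NormedSpace ℝ B] [NormedAddCommGroup G] [NormedSpace ℝ G]

theorem _root_.HasFDerivAt.clm_comp_const {f : G → B →L[ℝ] ℝ} {f' : G →L[ℝ] B →L[ℝ] ℝ} {x : G}
    (h : HasFDerivAt f f' x) (T : A →L[ℝ] B) :
    HasFDerivAt (fun y => (f y).comp T) ((ContinuousLinearMap.precomp ℝ T).comp f') x := by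
  have h1 := (ContinuousLinearMap.precomp ℝ T).hasFDerivAt (x := f x)
  exact h1.comp x h

end Calculus

section Mechanics

variable {E : Type*} [NormedAddCommGroup E] [NormedSpace ℝ E]
  {Q : Type*} [TopologicalSpace Q] [ChartedSpace E Q] [IsManifold 𝓘(ℝ, E) ∞ Q]

theorem contMDiff_tauQ : ContMDiff (TI E) 𝓘(ℝ, E) ∞ (tauQ : TB E Q → Q) :=
  Bundle.contMDiff_proj _

theorem contMDiff_piQ : ContMDiff (CI E) 𝓘(ℝ, E) ∞ (piQ : CB E Q → Q) :=
  Bundle.contMDiff_proj _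

theorem extChartAt_TB_fst (v w : TB E Q) :
    (extChartAt (TI E) v w).1 = extChartAt 𝓘(ℝ, E) v.proj w.proj := rfl

theorem extChartAt_CB_fst (a b : CB E Q) :
    (extChartAt (CI E) a b).1 = extChartAt 𝓘(ℝ, E) a.proj b.proj := rfl

theorem extChartAt_CB_symm_proj (a : CB E Q) {y : E × (E →L[ℝ] ℝ)}
    (hy : y ∈ (extChartAt (CI E) a).target) :
    ((extChartAt (CI E) a).symm y).proj = (extChartAt 𝓘(ℝ, E) a.proj).symm y.1 := by
  have h1 : (extChartAt (CI E) a).target = _ := FiberBundle.extChartAt_target a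
  have h2 : extChartAt (CI E) a = _ := FiberBundle.extChartAt a
  rw [h1] at hy
  rw [h2]
  exact Trivialization.proj_symm_apply' (trivializationAt (E →L[ℝ] ℝ)
    (fun q : Q => TangentSpace 𝓘(ℝ, E) q →L[ℝ] Bundle.Trivial Q ℝ q) a.proj) hy.1.2

theorem TtauQ_apply (v : TB E Q) (X : E × E) : TtauQ v X = X.1 := by
  have h : HasMFDerivAt (TI E) 𝓘(ℝ, E) (tauQ : TB E Q → Q) v
      (ContinuousLinearMap.fst ℝ E E : E × E →L[ℝ] E) := by
    refine ⟨contMDiff_tauQ.continuous.continuousAt, HasFDerivAt.hasFDerivWithinAt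
      ((hasFDerivAt_fst (𝕜 := ℝ) (p := extChartAt (TI E) v v)).congr_of_eventuallyEq ?_)⟩
    filter_upwards [extChartAt_target_mem_nhds (I := TI E) v] with y hy
    have h1 := extChartAt_TB_fst v ((extChartAt (TI E) v).symm y)
    rw [(extChartAt (TI E) v).right_inv hy] at h1
    exact h1.symm
  exact DFunLike.congr_fun h.mfderiv X

theorem TpiQ_apply (a : CB E Q) (X : E × (E →L[ℝ] ℝ)) : TpiQ a X = X.1 := by
  have h : HasMFDerivAt (CI E) 𝓘(ℝ, E) (piQ : CB E Q → Q) a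
      (ContinuousLinearMap.fst ℝ E (E →L[ℝ] ℝ) : E × (E →L[ℝ] ℝ) →L[ℝ] E) := by
    refine ⟨contMDiff_piQ.continuous.continuousAt, HasFDerivAt.hasFDerivWithinAt
      ((hasFDerivAt_fst (𝕜 := ℝ) (p := extChartAt (CI E) a a)).congr_of_eventuallyEq ?_)⟩
    filter_upwards [extChartAt_target_mem_nhds (I := CI E) a] with y hy
    have h1 := extChartAt_CB_fst a ((extChartAt (CI E) a).symm y)
    rw [(extChartAt (CI E) a).right_inv hy] at h1
    exact h1.symm
  exact DFunLike.congr_fun h.mfderiv X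

theorem hasMFDerivAt_extChartAt_symm {q : Q} {x : E} (hx : x ∈ (extChartAt 𝓘(ℝ, E) q).target) :
    HasMFDerivAt 𝓘(ℝ, E) 𝓘(ℝ, E) (extChartAt 𝓘(ℝ, E) q).symm x
      (chartFrame q x : E →L[ℝ] E) :=
  (((contMDiffOn_extChartAt_symm (n := ∞) q).contMDiffAt
    ((isOpen_extChartAt_target q).mem_nhds hx)).mdifferentiableAt (by simp)).hasMFDerivAt

/-- Since `S` is the vertical lift after `Tτ_Q`, the form `α_L` is the covector `FL(v)` composed
with `Tτ_Q`; in the chart this is `(∂L/∂v^A) dq^A`. -/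
theorem inChart_alphaL {L : TB E Q → ℝ} (hL : ContMDiff (TI E) 𝓘(ℝ, ℝ) ∞ L) (v : TB E Q)
    {y : E × E} (hy : y ∈ (extChartAt (TI E) v).target) :
    OneForm.inChart (TI E) (alphaL L) v y =
      (fibreDeriv (chartLagrangian L v.proj) y).comp (ContinuousLinearMap.fst ℝ E E) := by
  have hy1 := (mem_extChartAt_TB_target v y).1 hy
  have h1 : mfderiv 𝓘(ℝ, E × E) 𝓘(ℝ, E) (tauQ ∘ (extChartAt (TI E) v).symm) y =
      (TtauQ ((extChartAt (TI E) v).symm y)).comp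
        (mfderiv 𝓘(ℝ, E × E) (TI E) (extChartAt (TI E) v).symm y) :=
    mfderiv_comp y (contMDiff_tauQ.mdifferentiable (by simp) _)
      ((contMDiffAt_extChartAt_TB_symm v hy1).mdifferentiableAt (by simp))
  have h2 : HasMFDerivAt 𝓘(ℝ, E × E) 𝓘(ℝ, E) (tauQ ∘ (extChartAt (TI E) v).symm) y
      ((chartFrame v.proj y.1).comp (ContinuousLinearMap.fst ℝ E E) : E × E →L[ℝ] E) := by
    have h3 := hasMFDerivAt_extChartAt_symm hy1
    have h4 : HasMFDerivAt 𝓘(ℝ, E × E) 𝓘(ℝ, E) (Prod.fst : E × E → E) y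
      (ContinuousLinearMap.fst ℝ E E) := (hasFDerivAt_fst (𝕜 := ℝ) (p := y)).hasMFDerivAt
    have h5 := h3.comp y h4
    refine h5.congr_of_eventuallyEq ?_
    filter_upwards [(isOpen_extChartAt_target v).mem_nhds hy] with z hz
    rw [Function.comp_apply, extChartAt_TB_symm v ((mem_extChartAt_TB_target v z).1 hz)]
    rfl
  have h6 := h1.symm.trans h2.mfderiv
  have h7 := fibreDeriv_chartLagrangian hL v.proj hy1
  rw [← extChartAt_TB_symm v hy1] at h7
  rw [h7, ContinuousLinearMap.comp_assoc]
  exact congrArg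
    (ContinuousLinearMap.comp (covector (legendre L ((extChartAt (TI E) v).symm y)))) h6

theorem inChart_liouvilleForm (a : CB E Q)
    {y : E × (E →L[ℝ] ℝ)} (hy : y ∈ (extChartAt (CI E) a).target) :
    OneForm.inChart (CI E) liouvilleForm a y =
      y.2.comp (ContinuousLinearMap.fst ℝ E (E →L[ℝ] ℝ)) := by
  set b := (extChartAt (CI E) a).symm y with hb
  have hab : extChartAt (CI E) a b = y := (extChartAt (CI E) a).right_inv hy
  have hbp : b.proj = (extChartAt 𝓘(ℝ, E) a.proj).symm y.1 := extChartAt_CB_symm_proj a hy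
  have h0 : (extChartAt (CI E) a).target = _ := FiberBundle.extChartAt_target a
  have hy1 : y.1 ∈ (extChartAt 𝓘(ℝ, E) a.proj).target := by
    have := hy
    rw [h0] at this
    exact this.1.1
  have h1 : mfderiv 𝓘(ℝ, E × (E →L[ℝ] ℝ)) 𝓘(ℝ, E) (piQ ∘ (extChartAt (CI E) a).symm) y =
      (TpiQ b).comp
        (mfderiv 𝓘(ℝ, E × (E →L[ℝ] ℝ)) (CI E) (extChartAt (CI E) a).symm y) :=
    mfderiv_comp y (contMDiff_piQ.mdifferentiable (by simp) _)
      (((contMDiffOn_extChartAt_symm (n := ∞) a).contMDiffAt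
        ((isOpen_extChartAt_target a).mem_nhds hy)).mdifferentiableAt (by simp))
  have h2 : HasMFDerivAt 𝓘(ℝ, E × (E →L[ℝ] ℝ)) 𝓘(ℝ, E) (piQ ∘ (extChartAt (CI E) a).symm) y
      ((chartFrame a.proj y.1).comp (ContinuousLinearMap.fst ℝ E (E →L[ℝ] ℝ)) :
        E × (E →L[ℝ] ℝ) →L[ℝ] E) := by
    have h3 := hasMFDerivAt_extChartAt_symm hy1
    have h4 : HasMFDerivAt 𝓘(ℝ, E × (E →L[ℝ] ℝ)) 𝓘(ℝ, E) (Prod.fst : E × (E →L[ℝ] ℝ) → E) y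
      (ContinuousLinearMap.fst ℝ E (E →L[ℝ] ℝ)) :=
      (hasFDerivAt_fst (𝕜 := ℝ) (p := y)).hasMFDerivAt
    have h5 := h3.comp y h4
    refine h5.congr_of_eventuallyEq ?_
    filter_upwards [(isOpen_extChartAt_target a).mem_nhds hy] with z hz
    exact extChartAt_CB_symm_proj a hz
  have h6 := h1.symm.trans h2.mfderiv
  have h7 : extChartAt 𝓘(ℝ, E) a.proj b.proj = y.1 := by
    rw [hbp, (extChartAt 𝓘(ℝ, E) a.proj).right_inv hy1]
  have h8 := extChartAt_CB a b (by
    rw [hbp]; exact (extChartAt 𝓘(ℝ, E) a.proj).map_target hy1)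
  rw [hab, h7] at h8
  have h9 : y.2 = (covector b).comp (chartFrame a.proj y.1) := congrArg Prod.snd h8
  rw [h9, ContinuousLinearMap.comp_assoc]
  exact congrArg (ContinuousLinearMap.comp (covector b)) h6

/-- The second derivative of the Lagrangian at `v`, once along the fibre, in the preferred
chart. -/
def fibreHess (L : TB E Q → ℝ) (v : TB E Q) : E × E →L[ℝ] E →L[ℝ] ℝ :=
  fderiv ℝ (fibreDeriv (chartLagrangian L v.proj)) (extChartAt (TI E) v v)

theorem hasFDerivAt_fibreDeriv {L : TB E Q → ℝ} (hL : ContMDiff (TI E) 𝓘(ℝ, ℝ) ∞ L)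
    (v : TB E Q) : HasFDerivAt (fibreDeriv (chartLagrangian L v.proj)) (fibreHess L v)
      (extChartAt (TI E) v v) := by
  have hz : (extChartAt (TI E) v v).1 ∈ (extChartAt 𝓘(ℝ, E) v.proj).target := by
    rw [extChartAt_TB_self]; exact mem_extChartAt_target _
  exact ((contDiffAt_fibreDeriv hL v.proj hz).differentiableAt (by simp)).hasFDerivAt

theorem Tlegendre_apply {L : TB E Q → ℝ} (hL : ContMDiff (TI E) 𝓘(ℝ, ℝ) ∞ L) (v : TB E Q)
    (X : E × E) : (Tlegendre L v X : E × (E →L[ℝ] ℝ)) = (X.1, fibreHess L v X) :=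
  DFunLike.congr_fun (hasMFDerivAt_legendre hL v).mfderiv X

theorem omegaL_apply {L : TB E Q → ℝ} (hL : ContMDiff (TI E) 𝓘(ℝ, ℝ) ∞ L) (v : TB E Q)
    (X Y : E × E) : omegaL L v X Y = fibreHess L v Y X.1 - fibreHess L v X Y.1 := by
  have := IsManifold.of_le (I := TI E) (M := TB E Q) (m := 1) (n := ∞) (by simp)
  have h1 : HasFDerivAt (OneForm.inChart (TI E) (alphaL L) v)
      ((ContinuousLinearMap.precomp ℝ (ContinuousLinearMap.fst ℝ E E)).comp
        (fibreHess L v)) (extChartAt (TI E) v v) := by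
    refine ((hasFDerivAt_fibreDeriv hL v).clm_comp_const
      (ContinuousLinearMap.fst ℝ E E)).congr_of_eventuallyEq ?_
    filter_upwards [extChartAt_target_mem_nhds (I := TI E) v] with y hy
    exact inChart_alphaL hL v hy
  have h2 := OneForm.d_eq h1 X Y
  unfold omegaL
  rw [h2]
  simp

theorem omegaQ_apply (a : CB E Q) (X Y : E × (E →L[ℝ] ℝ)) :
    omegaQ a X Y = Y.2 X.1 - X.2 Y.1 := by
  have := IsManifold.of_le (I := CI E) (M := CB E Q) (m := 1) (n := ∞) (by simp)
  have h1 : HasFDerivAt (OneForm.inChart (CI E) liouvilleForm a)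
      ((ContinuousLinearMap.precomp ℝ
        (ContinuousLinearMap.fst ℝ E (E →L[ℝ] ℝ))).comp
          (ContinuousLinearMap.snd ℝ E (E →L[ℝ] ℝ))) (extChartAt (CI E) a a) := by
    refine ((hasFDerivAt_snd (𝕜 := ℝ) (p := extChartAt (CI E) a a)).clm_comp_const
      (ContinuousLinearMap.fst ℝ E (E →L[ℝ] ℝ))).congr_of_eventuallyEq ?_
    filter_upwards [extChartAt_target_mem_nhds (I := CI E) a] with y hy
    exact inChart_liouvilleForm a hy
  have h2 := OneForm.d_eq h1 X Y
  unfold omegaQ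
  rw [h2]
  simp

/-- On vertical directions `fibreHess` is a genuine second derivative of the local Lagrangian. -/
theorem fibreHess_symm {L : TB E Q → ℝ} (hL : ContMDiff (TI E) 𝓘(ℝ, ℝ) ∞ L) (v : TB E Q)
    (w w' : E) : fibreHess L v (0, w) w' = fibreHess L v (0, w') w := by
  have hz : (extChartAt (TI E) v v).1 ∈ (extChartAt 𝓘(ℝ, E) v.proj).target := by
    rw [extChartAt_TB_self]; exact mem_extChartAt_target _
  have h1 := contDiffAt_chartLagrangian hL v.proj hz
  have h2 : IsSymmSndFDerivAt ℝ (chartLagrangian L v.proj) (extChartAt (TI E) v v) :=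
    h1.isSymmSndFDerivAt (by
      rw [minSmoothness_of_isRCLikeNormedField]; exact ENat.LEInfty.out)
  have h3 : HasFDerivAt (fderiv ℝ (chartLagrangian L v.proj))
      (fderiv ℝ (fderiv ℝ (chartLagrangian L v.proj)) (extChartAt (TI E) v v))
      (extChartAt (TI E) v v) :=
    ((h1.fderiv_right (m := ∞) (by simp)).differentiableAt (by simp)).hasFDerivAt
  have h4 : fibreHess L v = (ContinuousLinearMap.precomp ℝ (ContinuousLinearMap.inr ℝ E E)).comp
      (fderiv ℝ (fderiv ℝ (chartLagrangian L v.proj)) (extChartAt (TI E) v v)) :=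
    (hasFDerivAt_fibreDeriv hL v).unique
      (h3.clm_comp_const (ContinuousLinearMap.inr ℝ E E))
  rw [h4]
  exact h2 (0, w) (0, w')

theorem energy_eq (L : TB E Q → ℝ) (v : TB E Q) :
    energy L v = covector (legendre L v) (vec v) - L v := rfl

theorem energy_extChartAt_symm {L : TB E Q → ℝ} (hL : ContMDiff (TI E) 𝓘(ℝ, ℝ) ∞ L) (v : TB E Q)
    {y : E × E} (hy : y.1 ∈ (extChartAt 𝓘(ℝ, E) v.proj).target) :
    energy L ((extChartAt (TI E) v).symm y) =
      fibreDeriv (chartLagrangian L v.proj) y y.2 - chartLagrangian L v.proj y := by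
  rw [extChartAt_TB_symm v hy, energy_eq, fibreDeriv_chartLagrangian hL _ hy]
  rfl

theorem contMDiff_energy {L : TB E Q → ℝ} (hL : ContMDiff (TI E) 𝓘(ℝ, ℝ) ∞ L) :
    ContMDiff (TI E) 𝓘(ℝ, ℝ) ∞ (energy L) := by
  intro v
  have hz : (extChartAt (TI E) v v).1 ∈ (extChartAt 𝓘(ℝ, E) v.proj).target := by
    rw [extChartAt_TB_self]; exact mem_extChartAt_target _
  have h1 : ContDiffAt ℝ ∞ (fun y : E × E => fibreDeriv (chartLagrangian L v.proj) y y.2 -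
      chartLagrangian L v.proj y) (extChartAt (TI E) v v) :=
    ((contDiffAt_fibreDeriv hL v.proj hz).clm_apply contDiffAt_snd).sub
      (contDiffAt_chartLagrangian hL v.proj hz)
  have h2 := h1.contMDiffAt.comp v (contMDiffAt_extChartAt (I := TI E) (n := ∞) (x := v))
  refine h2.congr_of_eventuallyEq ?_
  filter_upwards [extChartAt_source_mem_nhds (I := TI E) v] with w hw
  have h3 := (mem_extChartAt_TB_target v _).1 ((extChartAt (TI E) v).map_source hw)
  have h4 := energy_extChartAt_symm hL v h3
  rw [(extChartAt (TI E) v).left_inv hw] at h4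
  exact h4

/-- In `E_L = p_A v^A - L` the variation of `v^A` against `p_A` cancels the fibre derivative of `L`;
only the variation of `p_A` survives. -/
theorem dTB_energy_vertical {L : TB E Q → ℝ} (hL : ContMDiff (TI E) 𝓘(ℝ, ℝ) ∞ L) (v : TB E Q)
    (w : E) : dTB (energy L) v ((0, w) : E × E) = fibreHess L v (0, w) (vec v) := by
  have hz : (extChartAt (TI E) v v).1 ∈ (extChartAt 𝓘(ℝ, E) v.proj).target := by
    rw [extChartAt_TB_self]; exact mem_extChartAt_target _
  have h0 := ((contDiffAt_chartLagrangian hL v.proj hz).differentiableAt (by simp)).hasFDerivAt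
  have h1 := ((hasFDerivAt_fibreDeriv hL v).clm_apply
    (hasFDerivAt_snd (𝕜 := ℝ) (p := extChartAt (TI E) v v))).sub h0
  have h2 : HasMFDerivAt (TI E) 𝓘(ℝ, ℝ) (energy L) v
      ((fibreDeriv (chartLagrangian L v.proj) (extChartAt (TI E) v v)).comp
        (ContinuousLinearMap.snd ℝ E E) + (fibreHess L v).flip (extChartAt (TI E) v v).2 -
        fderiv ℝ (chartLagrangian L v.proj) (extChartAt (TI E) v v) : E × E →L[ℝ] ℝ) := by
    refine ⟨(contMDiff_energy hL).continuous.continuousAt, HasFDerivAt.hasFDerivWithinAt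
      (h1.congr_of_eventuallyEq ?_)⟩
    filter_upwards [extChartAt_target_mem_nhds (I := TI E) v] with y hy
    exact energy_extChartAt_symm hL v ((mem_extChartAt_TB_target v y).1 hy)
  refine (DFunLike.congr_fun h2.mfderiv ((0, w) : E × E)).trans ?_
  have h3 : (extChartAt (TI E) v v).2 = vec v := by rw [extChartAt_TB_self]
  rw [← h3]
  change fderiv ℝ (chartLagrangian L v.proj) (extChartAt (TI E) v v) (0, w) +
    fibreHess L v (0, w) (extChartAt (TI E) v v).2 -
    fderiv ℝ (chartLagrangian L v.proj) (extChartAt (TI E) v v) (0, w) = _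
  ring

/-- This is `γ^*ω_Q = -dγ`: in the chart the section is the graph of the local expression of `γ`. -/
theorem omegaQ_toCB_eq_zero {γ : OneForm 𝓘(ℝ, E) Q} (hγ : ContMDiff 𝓘(ℝ, E) (CI E) ∞ (toCB γ))
    {q : Q} (hd : ∀ u v : TangentSpace 𝓘(ℝ, E) q, OneForm.d 𝓘(ℝ, E) γ q u v = 0)
    (u v : TangentSpace 𝓘(ℝ, E) q) :
    omegaQ (toCB γ q) (mfderiv 𝓘(ℝ, E) (CI E) (toCB γ) q u)
      (mfderiv 𝓘(ℝ, E) (CI E) (toCB γ) q v) = 0 := by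
  have := IsManifold.of_le (I := 𝓘(ℝ, E)) (M := Q) (m := 1) (n := ∞) (by simp)
  have h1 := (hγ.mdifferentiable (by simp) q).hasMFDerivAt
  set T : E →L[ℝ] E × (E →L[ℝ] ℝ) := mfderiv 𝓘(ℝ, E) (CI E) (toCB γ) q with hT
  have h2 : HasFDerivAt (writtenInExtChartAt 𝓘(ℝ, E) (CI E) q (toCB γ)) T
      (extChartAt 𝓘(ℝ, E) q q) := by
    have := h1.2
    rw [modelWithCornersSelf_coe, range_id] at this
    exact hasFDerivWithinAt_univ.1 this
  have h3 : HasFDerivAt (fun y : E => (y, OneForm.inChart 𝓘(ℝ, E) γ q y)) T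
      (extChartAt 𝓘(ℝ, E) q q) := by
    refine h2.congr_of_eventuallyEq ?_
    filter_upwards [extChartAt_target_mem_nhds (I := 𝓘(ℝ, E)) q] with y hy
    have h4 := extChartAt_CB (toCB γ q) (toCB γ ((extChartAt 𝓘(ℝ, E) q).symm y))
      ((extChartAt 𝓘(ℝ, E) q).map_target hy)
    have h5 : (toCB γ q).proj = q := rfl
    have h6 : (toCB γ ((extChartAt 𝓘(ℝ, E) q).symm y)).proj = (extChartAt 𝓘(ℝ, E) q).symm y := rfl
    rw [h5, h6, (extChartAt 𝓘(ℝ, E) q).right_inv hy] at h4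
    exact h4.symm
  have h7 : HasFDerivAt (OneForm.inChart 𝓘(ℝ, E) γ q)
      ((ContinuousLinearMap.snd ℝ E (E →L[ℝ] ℝ)).comp T) (extChartAt 𝓘(ℝ, E) q q) := h3.snd
  have h8 : (ContinuousLinearMap.fst ℝ E (E →L[ℝ] ℝ)).comp T = ContinuousLinearMap.id ℝ E :=
    h3.fst.unique (hasFDerivAt_id _)
  have h9 := OneForm.d_eq h7 u v
  rw [hd u v] at h9
  have h10 := omegaQ_apply (toCB γ q) (T u) (T v)
  have e1 : (T u).1 = u := DFunLike.congr_fun h8 u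
  have e2 : (T v).1 = v := DFunLike.congr_fun h8 v
  rw [e1, e2] at h10
  refine h10.trans ?_
  have h11 : (T u).2 v - (T v).2 u = 0 := h9.symm
  linarith

end Mechanics

/-! ### The kernel and the fibres of the Legendre transformation. -/

section Mechanics

variable {E : Type*} [NormedAddCommGroup E] [NormedSpace ℝ E]
  {Q : Type*} [TopologicalSpace Q] [ChartedSpace E Q] [IsManifold 𝓘(ℝ, E) ∞ Q]

section Smooth

variable {L : TB E Q → ℝ}

theorem TpiQ_Tlegendre (hL : ContMDiff (TI E) 𝓘(ℝ, ℝ) ∞ L) (v : TB E Q)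
    (X : TangentSpace (TI E) v) : TpiQ (legendre L v) (Tlegendre L v X) = TtauQ v X := by
  have h1 := TpiQ_apply (legendre L v) (Tlegendre L v X)
  have h2 := TtauQ_apply v X
  have h3 := congrArg Prod.fst (Tlegendre_apply hL v X)
  exact h1.trans (h3.trans h2.symm)

theorem omegaL_eq_omegaQ (hL : ContMDiff (TI E) 𝓘(ℝ, ℝ) ∞ L) (v : TB E Q)
    (X Y : TangentSpace (TI E) v) :
    omegaL L v X Y = omegaQ (legendre L v) (Tlegendre L v X) (Tlegendre L v Y) := by
  have h1 := omegaL_apply hL v X Y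
  have h2 := omegaQ_apply (legendre L v) (Tlegendre L v X) (Tlegendre L v Y)
  rw [h1, h2]
  have h3 := Tlegendre_apply hL v X
  have h4 := Tlegendre_apply hL v Y
  rw [h3, h4]

/-- For vertical `X`, test vectors `(w, 0)` read off all values of `fibreHess L v X`, the fibre part
of `TFL(X)`. -/
theorem Tlegendre_eq_zero_of_omegaL (hL : ContMDiff (TI E) 𝓘(ℝ, ℝ) ∞ L) (v : TB E Q)
    {X : E × E} (hX : X.1 = 0) (h : ∀ Y : E × E, omegaL L v X Y = 0) :
    (Tlegendre L v X : E × (E →L[ℝ] ℝ)) = 0 := by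
  rw [Tlegendre_apply hL v X]
  refine Prod.ext hX ?_
  ext w
  have h1 := h (w, 0)
  rw [omegaL_apply hL, hX, map_zero, zero_sub, neg_eq_zero] at h1
  exact h1

/-- On vertical test vectors the equation compares the Hessian evaluated on `X.1` and on the
velocity; symmetry then puts the vertical lift of the SODE defect `X.1 - v` into `ker TFL`. -/
theorem Tlegendre_vertical_eq_zero (hL : ContMDiff (TI E) 𝓘(ℝ, ℝ) ∞ L) (v : TB E Q)
    {X : E × E} (h : ∀ Y : E × E, omegaL L v X Y = dTB (energy L) v Y) :
    (Tlegendre L v ((0, X.1 - vec v) : E × E) : E × (E →L[ℝ] ℝ)) = 0 := by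
  rw [Tlegendre_apply hL v]
  refine Prod.ext rfl ?_
  ext w
  have h1 := h (0, w)
  rw [omegaL_apply hL, dTB_energy_vertical hL, map_zero, sub_zero] at h1
  rw [fibreHess_symm hL, map_sub, h1, sub_self]
  rfl

theorem dTB_energy_eq_zero (hL : ContMDiff (TI E) 𝓘(ℝ, ℝ) ∞ L) (v : TB E Q)
    {X : E × E} (h : (Tlegendre L v X : E × (E →L[ℝ] ℝ)) = 0) :
    dTB (energy L) v X = 0 := by
  rw [Tlegendre_apply hL v] at h
  have h1 : X.1 = 0 := congrArg Prod.fst h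
  have h2 : fibreHess L v X = 0 := congrArg Prod.snd h
  have h3 : X = (0, X.2) := Prod.ext h1 rfl
  rw [h3, dTB_energy_vertical hL, ← h3, h2]
  rfl

theorem AlmostRegular.isSubmersionInto (hL : AlmostRegular L) :
    IsSubmersionInto (TI E) (CI E) (legendre L) (primarySet L) where
  smooth := contMDiff_legendre hL.smooth
  submanifold := hL.submanifold
  mem := fun v => ⟨v, rfl⟩
  surj := hL.submersion

theorem setM_subset (k : ℕ) : setM L k ⊆ primarySet L := by
  induction k with
  | zero => exact subset_rfl
  | succ k ih => exact fun a ha => ih ha.1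

theorem legendre_mkTB_eq_iff (q : Q) (w w' : E) :
    legendre L (mkTB q w) = legendre L (mkTB q w') ↔
      covector (legendre L (mkTB q w)) = covector (legendre L (mkTB q w')) :=
  ⟨fun h => by rw [h], fun h => TotalSpace.mk_inj.2 h⟩

variable [FiniteDimensional ℝ E]

/-- `dE_L` vanishes on `ker TFL`, so the energy is locally constant on the fibres; these being
connected, the choice made in `primaryHamiltonian` is immaterial. -/
theorem AlmostRegular.primaryHamiltonian_comp (hL : AlmostRegular L) :
    primaryHamiltonian L ∘ legendre L = energy L := by
  have := FiniteDimensional.complete ℝ E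
  ext v
  have hv : ∃ w : TB E Q, legendre L w = legendre L v := ⟨v, rfl⟩
  rw [Function.comp_apply, primaryHamiltonian, dif_pos hv]
  exact hL.isSubmersionInto.eq_of_fibre (contMDiff_energy hL.smooth)
    (fun x u hu => dTB_energy_eq_zero hL.smooth x hu)
    (hL.connected _ ⟨v, rfl⟩).isPreconnected hv.choose_spec rfl

/-- `FL` pulls `ω_Q` and `h_1` back to `ω_L` and `E_L`. In particular `P_f` contains every fibre of
`FL` that it meets. -/
theorem AlmostRegular.setP_eq (hL : AlmostRegular L) (k : ℕ) :
    setP L k = legendre L ⁻¹' setM L k := by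
  have := FiniteDimensional.complete ℝ E
  have h := hL.isSubmersionInto.constraintSet_eq (Ω := omegaL L) (Ω' := omegaQ)
    (h := primaryHamiltonian L) (fun p u v => omegaL_eq_omegaQ hL.smooth p u v)
    (by rw [hL.primaryHamiltonian_comp]; exact contMDiff_energy hL.smooth) k
  rw [hL.primaryHamiltonian_comp] at h
  exact h

/-- A fibre of the Legendre transformation contains the point `v₀` of its affine hull if at each
of its points `w` the vertical vector `v₀ - w` is tangent to it. -/
theorem AlmostRegular.legendre_eq_of_radial (hL : AlmostRegular L) (q : Q) (w₀ v₀ : E)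
    (h : ∀ w : E, legendre L (mkTB q w) = legendre L (mkTB q w₀) →
      (Tlegendre L (mkTB q w) ((0, v₀ - w) : E × E) : E × (E →L[ℝ] ℝ)) = 0) :
    legendre L (mkTB q v₀) = legendre L (mkTB q w₀) := by
  have := FiniteDimensional.complete ℝ E
  have := FiniteDimensional.proper_real E
  set S : Set E := {w | legendre L (mkTB q w) = legendre L (mkTB q w₀)} with hS
  have hcont : Continuous fun w : E => covector (legendre L (mkTB q w)) := by
    have h1 : ContDiff ℝ ∞ (fun w : E => L (mkTB q w)) := by
      rw [← contMDiff_iff_contDiff]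
      exact hL.smooth.comp (contMDiff_fibre q)
    have h2 := h1.continuous_fderiv (by simp)
    refine h2.congr fun w => ?_
    rw [covector_legendre hL.smooth]
    rfl
  have hclosed : IsClosed S := by
    have : S = (fun w : E => covector (legendre L (mkTB q w))) ⁻¹'
        {covector (legendre L (mkTB q w₀))} := by
      ext w
      exact legendre_mkTB_eq_iff q w w₀
    rw [this]
    exact isClosed_singleton.preimage hcont
  -- A nearest point exists because `E` is proper. The constant curve at `FL(z)` will be lifted with
  -- initial velocity `v₀ - z`: a curve inside the fibre heading straight for `v₀`.
  obtain ⟨z, hz, hdist⟩ := hclosed.exists_infDist_eq_dist ⟨w₀, rfl⟩ v₀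
  have hmin : ∀ w ∈ S, ‖z - v₀‖ ≤ ‖w - v₀‖ := by
    intro w hw
    rw [← dist_eq_norm, ← dist_eq_norm, dist_comm z, ← hdist, dist_comm w]
    exact Metric.infDist_le_dist_of_mem hw
  suffices hzv : z = v₀ by rw [← hzv]; exact hz
  have hconst : IsCurve (CI E) (fun _ : ℝ => legendre L (mkTB q z)) (legendre L (mkTB q z))
      (mfderiv (TI E) (CI E) (legendre L) (mkTB q z) ((0, v₀ - z) : E × E)) := by
    have h1 : mfderiv (TI E) (CI E) (legendre L) (mkTB q z) ((0, v₀ - z) : E × E) = 0 := h z hz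
    rw [h1]
    exact isCurve_const _
  obtain ⟨b, hb, hbc⟩ := hL.isSubmersionInto.exists_curve_lift hconst
    (Eventually.of_forall fun _ => ⟨_, rfl⟩)
  have hbS : ∀ᶠ t in 𝓝 (0 : ℝ), b t = mkTB q (vec (b t)) ∧ vec (b t) ∈ S := by
    filter_upwards [hbc] with t ht
    have h1 : (b t).proj = q := congrArg TotalSpace.proj ht
    have h2 : b t = mkTB q (vec (b t)) := by
      rw [← h1]; rfl
    refine ⟨h2, ?_⟩
    change legendre L (mkTB q (vec (b t))) = _
    rw [← h2, ht]
    exact hz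
  have hchart : ContMDiffAt (TI E) 𝓘(ℝ, E × E) ∞ (extChartAt (TI E) (mkTB q z)) (mkTB q z) :=
    contMDiffAt_extChartAt
  have hcb := hb.comp hchart
  have hder : HasDerivAt (fun t => vec (b t)) (v₀ - z) 0 := by
    have h1 : DifferentiableAt ℝ (extChartAt (TI E) (mkTB q z) ∘ b) 0 :=
      mdifferentiableAt_iff_differentiableAt.1 (hcb.smooth.mdifferentiableAt (by simp))
    have h2 := h1.hasDerivAt
    have h3 : deriv (extChartAt (TI E) (mkTB q z) ∘ b) 0 = ((0, v₀ - z) : E × E) := by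
      have h4 := hcb.velocity
      have := IsManifold.of_le (I := TI E) (M := TB E Q) (m := 1) (n := ∞) (by simp)
      have h5 := mfderiv_extChartAt_self (I := TI E) (x := (mkTB q z : TB E Q))
      rw [h5, mfderiv_eq_fderiv] at h4
      exact h4
    rw [h3] at h2
    have h6 : HasDerivAt (fun t => ((extChartAt (TI E) (mkTB q z) ∘ b) t).2) (v₀ - z) 0 := h2.snd
    refine h6.congr_of_eventuallyEq ?_
    filter_upwards [hbS] with t ht
    rw [Function.comp_apply, ht.1]
    have := extChartAt_TB_mk (mkTB q z) (vec (b t))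
    rw [mkTB_proj] at this
    rw [this]
    rfl
  by_contra hne
  have hd : 0 < ‖z - v₀‖ := norm_pos_iff.2 (sub_ne_zero.2 hne)
  have hb0 : vec (b 0) = z := by rw [hb.eq]; rfl
  -- Let `d = ‖z - v₀‖`. With error at most `(d/2) t`, the distance to `v₀` at small `t > 0` is at
  -- most `(1 - t) d + (d/2) t < d`, against minimality.
  have h1 := (hasDerivAt_iff_isLittleO.1 hder).def (half_pos hd)
  have h2 : ∀ᶠ t in 𝓝 (0 : ℝ), t < 1 := eventually_lt_nhds one_pos
  obtain ⟨t, ⟨h3, h4, h5⟩, ht0⟩ := ((h1.and (hbS.and h2)).filter_mono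
    nhdsWithin_le_nhds |>.and (self_mem_nhdsWithin (s := Ioi (0 : ℝ)))).exists
  have ht : (0 : ℝ) < t := ht0
  rw [hb0, sub_zero, Real.norm_of_nonneg ht.le] at h3
  have h6 := hmin _ h4.2
  have h7 : vec (b t) - v₀ = (vec (b t) - z - t • (v₀ - z)) + (1 - t) • (z - v₀) := by
    module
  have h8 := norm_add_le (vec (b t) - z - t • (v₀ - z)) ((1 - t) • (z - v₀))
  rw [← h7, norm_smul, Real.norm_of_nonneg (by linarith)] at h8
  nlinarith [mul_pos ht hd]

end Smooth

end Mechanics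

/-! ### The section `β_ξ`, the field `X_ξ` and the Hamilton-Jacobi equation. -/

section Mechanics

variable {E : Type*} [NormedAddCommGroup E] [NormedSpace ℝ E]
  {Q : Type*} [TopologicalSpace Q] [ChartedSpace E Q] [IsManifold 𝓘(ℝ, E) ∞ Q]

section Beta

/-- The tangent vector `Tπ_Q(X(a))`, as a point of `TQ`. -/
def projField (X : ∀ a : CB E Q, TangentSpace (CI E) a) (a : CB E Q) : TB E Q :=
  ⟨a.proj, TpiQ a (X a)⟩

theorem contMDiffOn_projField {X : ∀ a : CB E Q, TangentSpace (CI E) a} {S : Set (CB E Q)}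
    (hX : IsVectorFieldOn (CI E) S X) : ContMDiffOn (CI E) (TI E) ∞ (projField X) S := by
  have h1 : ContMDiff (CI E).tangent (TI E) ∞
      (tangentMap (CI E) 𝓘(ℝ, E) (piQ : CB E Q → Q)) :=
    contMDiff_piQ.contMDiff_tangentMap (by simp)
  exact h1.comp_contMDiffOn hX.2

variable {L : TB E Q → ℝ} {k : ℕ} {ξ : ∀ v : TB E Q, TangentSpace (TI E) v}
  {X : ∀ a : CB E Q, TangentSpace (CI E) a}

theorem IsSODEPoint.eq_projField (hL : AlmostRegular L)
    (hproj : ∀ v ∈ setP L k, Tlegendre L v (ξ v) = X (legendre L v)) {a : CB E Q} {v : TB E Q}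
    (hv : IsSODEPoint L k ξ a v) : v = projField X a := by
  obtain ⟨hvP, rfl, hS⟩ := hv
  have h1 := TpiQ_Tlegendre hL.smooth v (ξ v)
  rw [hproj v hvP] at h1
  exact TotalSpace.mk_inj.2 (hS.symm.trans h1.symm)

variable [FiniteDimensional ℝ E]

/-- Projectability makes the base component of `ξ` equal to one vector `v₀` along the entire fibre,
so all the SODE defects `v₀ - w` point to the same `v₀`, as the nearest-point argument requires. -/
theorem isSODEPoint_projField (hL : AlmostRegular L)
    (hξsol : ∀ v ∈ setP L k, ∀ y : TangentSpace (TI E) v,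
      omegaL L v (ξ v) y = dTB (energy L) v y)
    (hproj : ∀ v ∈ setP L k, Tlegendre L v (ξ v) = X (legendre L v))
    {a : CB E Q} (ha : a ∈ setM L k) : IsSODEPoint L k ξ a (projField X a) := by
  obtain ⟨v, rfl⟩ := setM_subset k ha
  have hmem : ∀ w, legendre L w = legendre L v → w ∈ setP L k := by
    intro w hw
    rw [hL.setP_eq k, mem_preimage, hw]
    exact ha
  set v₀ : E := TpiQ (legendre L v) (X (legendre L v)) with hv₀
  have key : legendre L (mkTB v.proj v₀) = legendre L v := by
    refine hL.legendre_eq_of_radial v.proj (vec v) v₀ fun w hw => ?_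
    have hw' : legendre L (mkTB v.proj w) = legendre L v := hw
    have hwP := hmem _ hw'
    have h1 := Tlegendre_vertical_eq_zero hL.smooth (mkTB v.proj w) (hξsol _ hwP)
    have h2 := TtauQ_apply (mkTB v.proj w) (ξ (mkTB v.proj w))
    have h3 := TpiQ_Tlegendre hL.smooth (mkTB v.proj w) (ξ (mkTB v.proj w))
    rw [hproj _ hwP] at h3
    have h4 : ∀ b b' : CB E Q, b = b' → (TpiQ b (X b) : E) = TpiQ b' (X b') := by
      rintro b _ rfl; rfl
    have h5 : (ξ (mkTB v.proj w) : E × E).1 = v₀ :=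
      h2.symm.trans (h3.symm.trans (h4 _ _ hw'))
    rw [h5] at h1
    exact h1
  have hP := hmem _ key
  refine ⟨hP, key, ?_⟩
  have h3 := TpiQ_Tlegendre hL.smooth (mkTB v.proj v₀) (ξ (mkTB v.proj v₀))
  rw [hproj _ hP] at h3
  have h4 : ∀ b b' : CB E Q, b = b' → (TpiQ b (X b) : E) = TpiQ b' (X b') := by
    rintro b _ rfl; rfl
  exact h3.symm.trans (h4 _ _ key)

theorem beta_eq_projField (hL : AlmostRegular L)
    (hξsol : ∀ v ∈ setP L k, ∀ y : TangentSpace (TI E) v,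
      omegaL L v (ξ v) y = dTB (energy L) v y)
    (hproj : ∀ v ∈ setP L k, Tlegendre L v (ξ v) = X (legendre L v))
    {a : CB E Q} (ha : a ∈ setM L k) : beta L k ξ a = projField X a := by
  have h : ∃ v, IsSODEPoint L k ξ a v := ⟨_, isSODEPoint_projField hL hξsol hproj ha⟩
  rw [beta, dif_pos h]
  exact h.choose_spec.eq_projField hL hproj

theorem legendre_beta (hL : AlmostRegular L)
    (hξsol : ∀ v ∈ setP L k, ∀ y : TangentSpace (TI E) v,
      omegaL L v (ξ v) y = dTB (energy L) v y)
    (hproj : ∀ v ∈ setP L k, Tlegendre L v (ξ v) = X (legendre L v))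
    {a : CB E Q} (ha : a ∈ setM L k) : legendre L (beta L k ξ a) = a := by
  rw [beta_eq_projField hL hξsol hproj ha]
  exact (isSODEPoint_projField hL hξsol hproj ha).2.1

theorem contMDiffOn_beta (hL : AlmostRegular L)
    (hξsol : ∀ v ∈ setP L k, ∀ y : TangentSpace (TI E) v,
      omegaL L v (ξ v) y = dTB (energy L) v y)
    (hX : IsVectorFieldOn (CI E) (setM L k) X)
    (hproj : ∀ v ∈ setP L k, Tlegendre L v (ξ v) = X (legendre L v)) :
    ContMDiffOn (CI E) (TI E) ∞ (beta L k ξ) (setM L k) :=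
  (contMDiffOn_projField hX).congr fun _ ha => beta_eq_projField hL hξsol hproj ha

/-- A vector tangent to `Im(β_ξ)` is determined by its image under the Legendre transformation. -/
theorem eq_of_Tlegendre_eq (hL : AlmostRegular L)
    (hξsol : ∀ v ∈ setP L k, ∀ y : TangentSpace (TI E) v,
      omegaL L v (ξ v) y = dTB (energy L) v y)
    (hX : IsVectorFieldOn (CI E) (setM L k) X)
    (hproj : ∀ v ∈ setP L k, Tlegendre L v (ξ v) = X (legendre L v))
    {a : CB E Q} (ha : a ∈ setM L k) {x : TangentSpace (TI E) (beta L k ξ a)}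
    (hx : x ∈ tangentSet (TI E) (imBeta L k ξ) (beta L k ξ a)) :
    x = mfderivWithin (CI E) (TI E) (beta L k ξ) (setM L k) a
      (Tlegendre L (beta L k ξ a) x : E × (E →L[ℝ] ℝ)) := by
  obtain ⟨b, hb, hbS⟩ := mem_tangentSet_iff.1 hx
  have hβ := contMDiffOn_beta hL hξsol hX hproj a ha
  have hc : IsCurve (CI E) (legendre L ∘ b) a
      (Tlegendre L (beta L k ξ a) x : E × (E →L[ℝ] ℝ)) :=
    (hb.comp (contMDiff_legendre hL.smooth).contMDiffAt).of_eq
      (legendre_beta hL hξsol hproj ha)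
  -- A curve in `Im(β_ξ)` equals `β_ξ ∘ FL` of itself, so its velocity can be recovered from that of
  -- its image in `M_f`.
  have hbt : ∀ᶠ t in 𝓝 (0 : ℝ), legendre L (b t) ∈ setM L k ∧
      beta L k ξ (legendre L (b t)) = b t := by
    filter_upwards [hbS] with t ⟨a', ha', h⟩
    rw [← h, legendre_beta hL hξsol hproj ha']
    exact ⟨ha', rfl⟩
  have h1 := hc.comp_within (hbt.mono fun _ h => h.1) hβ
    (hβ.mdifferentiableWithinAt (by simp)).hasMFDerivWithinAt
  exact hb.velocity_unique (h1.congr (hbt.mono fun t h => h.2.symm))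

/-- The difference is vertical by the SODE condition and in `ker ω_L` by the equation, so `TFL`
kills it; on vectors tangent to `Im(β_ξ)` the map `TFL` is injective. -/
theorem isSODESolutionAt_unique (hL : AlmostRegular L)
    (hξsol : ∀ v ∈ setP L k, ∀ y : TangentSpace (TI E) v,
      omegaL L v (ξ v) y = dTB (energy L) v y)
    (hX : IsVectorFieldOn (CI E) (setM L k) X)
    (hproj : ∀ v ∈ setP L k, Tlegendre L v (ξ v) = X (legendre L v))
    {v : TB E Q} (hv : v ∈ imBeta L k ξ) {x x' : TangentSpace (TI E) v}
    (hx : IsSODESolutionAt L k ξ v x) (hx' : IsSODESolutionAt L k ξ v x') : x = x' := by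
  obtain ⟨a, ha, rfl⟩ := hv
  have h1 := eq_of_Tlegendre_eq hL hξsol hX hproj ha hx.1
  have h2 := eq_of_Tlegendre_eq hL hξsol hX hproj ha hx'.1
  have h3 : (Tlegendre L (beta L k ξ a) ((x - x' : E × E)) : E × (E →L[ℝ] ℝ)) = 0 := by
    refine Tlegendre_eq_zero_of_omegaL hL.smooth _ ?_ fun Y => ?_
    · have e1 := TtauQ_apply (beta L k ξ a) x
      have e2 := TtauQ_apply (beta L k ξ a) x'
      have e3 : (x : E × E).1 = (x' : E × E).1 :=
        e1.symm.trans (hx.2.2.trans (hx'.2.2.symm.trans e2))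
      exact sub_eq_zero.2 e3
    · have e1 := (hx.2.1 Y).trans (hx'.2.1 Y).symm
      have e2 := (omegaL_apply hL.smooth (beta L k ξ a) x Y).symm.trans
        (e1.trans (omegaL_apply hL.smooth (beta L k ξ a) x' Y))
      refine (omegaL_apply hL.smooth (beta L k ξ a) (x - x' : E × E) Y).trans ?_
      have e3 : fibreHess L (beta L k ξ a) (x - x' : E × E) = fibreHess L (beta L k ξ a) x -
        fibreHess L (beta L k ξ a) x' := map_sub (fibreHess L (beta L k ξ a)) (x : E × E) x'
      have e4 : fibreHess L (beta L k ξ a) Y (x - x' : E × E).1 =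
          fibreHess L (beta L k ξ a) Y (x : E × E).1 -
            fibreHess L (beta L k ξ a) Y (x' : E × E).1 :=
        map_sub (fibreHess L (beta L k ξ a) Y) (x : E × E).1 (x' : E × E).1
      rw [e3, e4, sub_apply]
      linarith
  have h4 : (Tlegendre L (beta L k ξ a) x : E × (E →L[ℝ] ℝ)) = Tlegendre L (beta L k ξ a) x' := by
    refine sub_eq_zero.1 (Eq.trans ?_ h3)
    exact (map_sub (Tlegendre L (beta L k ξ a)) x x').symm
  rw [h1, h2, h4]

/-- The witness is `Tβ_ξ(X(a))`. It has the same image under `TFL` as `ξ(β_ξ(a))`, from which it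
inherits the equation and the SODE condition. -/
theorem exists_isSODESolutionAt (hL : AlmostRegular L)
    (hξsol : ∀ v ∈ setP L k, ∀ y : TangentSpace (TI E) v,
      omegaL L v (ξ v) y = dTB (energy L) v y)
    (hX : IsVectorFieldOn (CI E) (setM L k) X)
    (hproj : ∀ v ∈ setP L k, Tlegendre L v (ξ v) = X (legendre L v))
    {v : TB E Q} (hv : v ∈ imBeta L k ξ) : ∃ x, IsSODESolutionAt L k ξ v x := by
  obtain ⟨a, ha, rfl⟩ := hv
  obtain ⟨c, hc, hcS⟩ := mem_tangentSet_iff.1 (hX.1 a ha)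
  have hβ := contMDiffOn_beta hL hξsol hX hproj a ha
  have h1 := hc.comp_within hcS hβ (hβ.mdifferentiableWithinAt (by simp)).hasMFDerivWithinAt
  set x := mfderivWithin (CI E) (TI E) (beta L k ξ) (setM L k) a (X a) with hx
  have hvP : beta L k ξ a ∈ setP L k := by
    rw [hL.setP_eq, mem_preimage, legendre_beta hL hξsol hproj ha]
    exact ha
  have hXa : ∀ b b' : CB E Q, b = b' → (X b : E × (E →L[ℝ] ℝ)) = X b' := by
    rintro b _ rfl; rfl
  have h2 : (Tlegendre L (beta L k ξ a) x : E × (E →L[ℝ] ℝ)) =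
      Tlegendre L (beta L k ξ a) (ξ (beta L k ξ a)) := by
    have h3 := (h1.comp (contMDiff_legendre hL.smooth).contMDiffAt).of_eq
      (legendre_beta hL hξsol hproj ha)
    have h4 := (hc.congr (c' := legendre L ∘ (beta L k ξ ∘ c)) (by
      filter_upwards [hcS] with t ht using legendre_beta hL hξsol hproj ht))
    have h5 := h3.velocity_unique h4
    have h6 := hproj _ hvP
    have h7 := hXa _ _ (legendre_beta hL hξsol hproj ha)
    exact h5.trans (h7.symm.trans h6.symm)
  refine ⟨x, mem_tangentSet_iff.2 ⟨_, h1, hcS.mono fun t ht => ⟨_, ht, rfl⟩⟩, fun y => ?_, ?_⟩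
  · rw [← hξsol _ hvP, omegaL_eq_omegaQ hL.smooth, omegaL_eq_omegaQ hL.smooth]
    exact congrArg (fun z => omegaQ (legendre L (beta L k ξ a)) z
      (Tlegendre L (beta L k ξ a) y)) h2
  · have h3 := TpiQ_Tlegendre hL.smooth _ x
    have h4 := TpiQ_Tlegendre hL.smooth _ (ξ (beta L k ξ a))
    have h5 : TtauQ (beta L k ξ a) (ξ (beta L k ξ a)) = (beta L k ξ a).snd := by
      have h6 := isSODEPoint_projField hL hξsol hproj ha
      rw [← beta_eq_projField hL hξsol hproj ha] at h6
      exact h6.2.2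
    refine Eq.trans ?_ h5
    rw [← h3, ← h4]
    exact congrArg (TpiQ (legendre L (beta L k ξ a))) h2

theorem fieldXi_eq (hL : AlmostRegular L)
    (hξsol : ∀ v ∈ setP L k, ∀ y : TangentSpace (TI E) v,
      omegaL L v (ξ v) y = dTB (energy L) v y)
    (hX : IsVectorFieldOn (CI E) (setM L k) X)
    (hproj : ∀ v ∈ setP L k, Tlegendre L v (ξ v) = X (legendre L v))
    {v : TB E Q} (hv : v ∈ imBeta L k ξ) {x : TangentSpace (TI E) v}
    (hx : IsSODESolutionAt L k ξ v x) : fieldXi L k ξ v = x := by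
  have h : ∃ x, IsSODESolutionAt L k ξ v x := ⟨x, hx⟩
  rw [fieldXi, dif_pos h]
  exact isSODESolutionAt_unique hL hξsol hX hproj hv h.choose_spec hx

/-- The values of `Tγ` and `X` along a solution of the Hamilton-Jacobi problem differ by an
element of the kernel of the restriction of `ω_Q` to `M_1`. -/
theorem omegaQ_HJ (hL : AlmostRegular L)
    (hξsol : ∀ v ∈ setP L k, ∀ y : TangentSpace (TI E) v,
      omegaL L v (ξ v) y = dTB (energy L) v y)
    (hproj : ∀ v ∈ setP L k, Tlegendre L v (ξ v) = X (legendre L v))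
    {γ : OneForm 𝓘(ℝ, E) Q} (hγ : IsHJSolution L k γ) {q : Q} (hq : q ∈ setQ L k)
    {v : TB E Q} (hv : legendre L v = toCB γ q) (hvP : v ∈ setP L k)
    {x : TangentSpace (TI E) v}
    (hx : (Tlegendre L v x : E × (E →L[ℝ] ℝ)) =
      mfderiv 𝓘(ℝ, E) (CI E) (toCB γ) q (fieldGamma X γ q))
    (y : TangentSpace (TI E) v) :
    omegaL L v x y = dTB (energy L) v y := by
  have := FiniteDimensional.complete ℝ E
  set T : E →L[ℝ] E × (E →L[ℝ] ℝ) := mfderiv 𝓘(ℝ, E) (CI E) (toCB γ) q with hT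
  have hfst : ∀ u : E, (T u).1 = u := by
    intro u
    have h1 : mfderiv 𝓘(ℝ, E) 𝓘(ℝ, E) (piQ ∘ toCB γ) q =
        (TpiQ (toCB γ q)).comp (mfderiv 𝓘(ℝ, E) (CI E) (toCB γ) q) :=
      mfderiv_comp q (contMDiff_piQ.mdifferentiable (by simp) _)
        (hγ.smooth.mdifferentiable (by simp) q)
    have h2 : mfderiv 𝓘(ℝ, E) 𝓘(ℝ, E) (piQ ∘ toCB γ) q = ContinuousLinearMap.id ℝ E :=
      mfderiv_id
    have h3 := TpiQ_apply (toCB γ q) (T u)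
    exact h3.symm.trans (DFunLike.congr_fun (h1.symm.trans h2) u)
  set W : E × (E →L[ℝ] ℝ) := Tlegendre L v y with hW
  set Xa : E × (E →L[ℝ] ℝ) := X (toCB γ q) with hXa
  set u₀ : E := fieldGamma X γ q with hu₀
  have hu₀X : u₀ = Xa.1 := TpiQ_apply (toCB γ q) Xa
  have hξX : (Tlegendre L v (ξ v) : E × (E →L[ℝ] ℝ)) = Xa := by
    have h1 : ∀ b b' : CB E Q, b = b' → (X b : E × (E →L[ℝ] ℝ)) = X b' := by
      rintro b _ rfl; rfl
    exact (hproj v hvP).trans (h1 _ _ hv)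
  have hω : ∀ z z' : TangentSpace (TI E) v, omegaL L v z z' =
      (Tlegendre L v z' : E × (E →L[ℝ] ℝ)).2 (Tlegendre L v z : E × (E →L[ℝ] ℝ)).1 -
        (Tlegendre L v z : E × (E →L[ℝ] ℝ)).2 (Tlegendre L v z' : E × (E →L[ℝ] ℝ)).1 :=
    fun z z' => (omegaL_eq_omegaQ hL.smooth v z z').trans (omegaQ_apply _ _ _)
  -- the closedness of `γ`
  have hclosed : (T W.1).2 u₀ - (T u₀).2 W.1 = 0 := by
    have h1 := omegaQ_toCB_eq_zero hγ.smooth (hγ.closed q) u₀ W.1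
    have h2 := omegaQ_apply (toCB γ q) (T u₀) (T W.1)
    rw [hfst, hfst] at h2
    exact h2.symm.trans h1
  -- the Hamilton-Jacobi equation
  have hHJ : (T W.1).2 Xa.1 - Xa.2 W.1 = 0 := by
    obtain ⟨e, he⟩ := exists_isCurve (J := 𝓘(ℝ, E)) (p := q) W.1
    have hc := (he.comp (hγ.smooth.contMDiffAt (x := q))).of_eq hv.symm
    have hcS : ∀ t, toCB γ (e t) ∈ primarySet L := fun t => hγ.mem_primary _
    -- As `h_1` lives only on `M_1`, its differential on `Tγ(W.1)` is computed upstairs: the curve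
    -- `γ ∘ e` in `M_1` lifts to `TQ`, the energy along the lift is `h_1 ∘ γ ∘ e`, and hence
    -- `dE_L(Z) = 0`.
    obtain ⟨Z, hZ⟩ := hL.submersion v _
      (mem_tangentSet_iff.2 ⟨_, hc, Eventually.of_forall hcS⟩)
    have hc' : IsCurve (CI E) (toCB γ ∘ e) (legendre L v)
        (mfderiv (TI E) (CI E) (legendre L) v Z) := by
      change IsCurve (CI E) (toCB γ ∘ e) (legendre L v) (Tlegendre L v Z)
      rw [hZ]
      exact hc
    obtain ⟨b, hb, hbc⟩ := hL.isSubmersionInto.exists_curve_lift hc' (Eventually.of_forall hcS)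
    have h1 := hb.comp (contMDiff_energy hL.smooth).contMDiffAt
    have h2 : ContMDiffAt 𝓘(ℝ, E) 𝓘(ℝ, ℝ) ∞ (primaryHamiltonian L ∘ toCB γ) q := by
      have h3 := hL.isSubmersionInto.contMDiffWithinAt_of_comp (h := primaryHamiltonian L)
        (by rw [hL.primaryHamiltonian_comp]; exact contMDiff_energy hL.smooth) v
      rw [hv] at h3
      exact contMDiffWithinAt_univ.1
        (h3.comp q (hγ.smooth.contMDiffAt.contMDiffWithinAt) fun r _ => hγ.mem_primary r)
    have h3 := he.comp h2
    have h4 : (primaryHamiltonian L ∘ toCB γ) ∘ e =ᶠ[𝓝 0] energy L ∘ b := by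
      filter_upwards [hbc] with t ht
      have h5 := congrFun hL.primaryHamiltonian_comp (b t)
      rw [Function.comp_apply] at h5
      rw [Function.comp_apply, Function.comp_apply, Function.comp_apply, ← h5, ht]
      rfl
    have h5 : dTB (energy L) v Z = 0 := by
      have h6 := (h1.congr h4).velocity
      have h7 := h3.velocity
      exact h6.symm.trans (h7.trans (hγ.hamiltonJacobi q hq W.1))
    have h6 := (hω (ξ v) Z).symm.trans ((hξsol v hvP Z).trans h5)
    have hZ' : (Tlegendre L v Z : E × (E →L[ℝ] ℝ)) = T W.1 := hZ
    rw [hξX, hZ', hfst] at h6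
    exact h6
  -- `Tγ(u₀)` and `X` have the same base component, so the terms in `W.2` cancel. What remains holds
  -- because, by the two preceding facts, both sides equal `(T W.1).2 u₀`.
  rw [← hξsol v hvP y, hω, hω, hξX, hx]
  change W.2 (T u₀).1 - (T u₀).2 W.1 = W.2 Xa.1 - Xa.2 W.1
  rw [hfst]
  rw [hu₀X] at hclosed ⊢
  linarith

end Beta

end Mechanics

end SingularHJ

end

/-! ### The main theorem. -/

open SingularHJ in
theorem mainTheorem5
    {E : Type*} [NormedAddCommGroup E] [NormedSpace ℝ E] [FiniteDimensional ℝ E]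
    {Q : Type*} [TopologicalSpace Q] [T2Space Q] [SecondCountableTopology Q]
    [ChartedSpace E Q] [IsManifold 𝓘(ℝ, E) ∞ Q]
    -- an almost regular Lagrangian for which the algorithm stabilizes at the step `k`
    (L : TB E Q → ℝ) (hL : AlmostRegular L) (k : ℕ)
    (hstep : ∀ i ≤ k, RegularStep L i)
    (hfinal : setP L (k + 1) = setP L k)
    -- a solution `ξ` on `P_f` that projects onto the vector field `X` on `M_f`
    (ξ : ∀ v : TB E Q, TangentSpace (TI E) v)
    (hξ : IsVectorFieldOn (TI E) (setP L k) ξ)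
    (hξsol : ∀ v ∈ setP L k, ∀ y : TangentSpace (TI E) v,
      omegaL L v (ξ v) y = dTB (energy L) v y)
    (X : ∀ a : CB E Q, TangentSpace (CI E) a)
    (hX : IsVectorFieldOn (CI E) (setM L k) X)
    (hproj : ∀ v ∈ setP L k, Tlegendre L v (ξ v) = X (legendre L v))
    -- a solution of the Hamilton-Jacobi problem
    (γ : OneForm 𝓘(ℝ, E) Q) (hγ : IsHJSolution L k γ) :
    -- `β_ξ` and `X_ξ` are well defined, and `X^γ` is a vector field on `Q_f`
    (∀ a ∈ setM L k, ∃! v, IsSODEPoint L k ξ a v) ∧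
    (∀ v ∈ imBeta L k ξ, ∃! x, IsSODESolutionAt L k ξ v x) ∧
    IsVectorFieldOn 𝓘(ℝ, E) (setQ L k) (fieldGamma X γ) ∧
    -- `β_ξ ∘ γ_f = X^γ` as maps `Q_f → TQ`
    (∀ q ∈ setQ L k, beta L k ξ (toCB γ q) = ⟨q, fieldGamma X γ q⟩) ∧
    -- `X_ξ` and `X^γ` are `β_ξ ∘ γ_f`-related
    ContMDiffOn 𝓘(ℝ, E) (TI E) ∞ (fun q => beta L k ξ (toCB γ q)) (setQ L k) ∧
    (∀ q ∈ setQ L k,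
      mfderivWithin 𝓘(ℝ, E) (TI E) (fun q => beta L k ξ (toCB γ q)) (setQ L k) q
        (fieldGamma X γ q) = fieldXi L k ξ (beta L k ξ (toCB γ q))) := by
  have hβ : ∀ a ∈ setM L k, beta L k ξ a = projField X a :=
    fun a ha => beta_eq_projField hL hξsol hproj ha
  have hβγ : ∀ q ∈ setQ L k, beta L k ξ (toCB γ q) = ⟨q, fieldGamma X γ q⟩ :=
    fun q hq => hβ _ (hγ.mem_final q hq)
  have hsmooth : ContMDiffOn 𝓘(ℝ, E) (TI E) ∞ (fun q => beta L k ξ (toCB γ q)) (setQ L k) :=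
    (contMDiffOn_beta hL hξsol hX hproj).comp hγ.smooth.contMDiffOn hγ.mem_final
  -- A curve in `M_f` realizing `X` at `γ(q)` projects to one in `Q_f` realizing `X^γ(q)`. Its image
  -- under `β_ξ ∘ γ_f` will represent the pushed-forward vector.
  have hcurve : ∀ q ∈ setQ L k, ∃ c : ℝ → Q,
      IsCurve 𝓘(ℝ, E) c q (fieldGamma X γ q) ∧ ∀ᶠ t in 𝓝 (0 : ℝ), c t ∈ setQ L k := by
    intro q hq
    obtain ⟨c, hc, hcS⟩ := mem_tangentSet_iff.1 (hX.1 _ (hγ.mem_final q hq))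
    exact ⟨piQ ∘ c, hc.comp contMDiff_piQ.contMDiffAt,
      hcS.mono fun t ht => mem_image_of_mem _ ht⟩
  refine ⟨fun a ha => ⟨_, isSODEPoint_projField hL hξsol hproj ha,
    fun v hv => hv.eq_projField hL hproj⟩, fun v hv => ?_, ⟨fun q hq => ?_, ?_⟩, hβγ, hsmooth,
    fun q hq => ?_⟩
  · obtain ⟨x, hx⟩ := exists_isSODESolutionAt hL hξsol hX hproj hv
    exact ⟨x, hx, fun x' hx' => isSODESolutionAt_unique hL hξsol hX hproj hv hx' hx⟩
  · exact mem_tangentSet_iff.2 (hcurve q hq)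
  · exact hsmooth.congr fun q hq => (hβγ q hq).symm
  · have ha := hγ.mem_final q hq
    obtain ⟨c, hc, hcS⟩ := hcurve q hq
    have h1 := hc.comp_within hcS (hsmooth q hq)
      ((hsmooth q hq).mdifferentiableWithinAt (by simp)).hasMFDerivWithinAt
    refine (fieldXi_eq hL hξsol hX hproj ⟨_, ha, rfl⟩ ⟨?_, ?_, ?_⟩).symm
    · exact mem_tangentSet_iff.2
        ⟨_, h1, hcS.mono fun t ht => ⟨_, hγ.mem_final _ ht, rfl⟩⟩
    · have hleg := legendre_beta hL hξsol hproj ha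
      refine omegaQ_HJ hL hξsol hproj hγ hq hleg ?_ ?_
      · rw [hL.setP_eq, mem_preimage, hleg]
        exact ha
      -- Along the curve `FL ∘ β_ξ ∘ γ_f = γ_f`, so `TFL` sends the pushed-forward vector to
      -- `Tγ(X^γ(q))`.
      · have h2 := (h1.comp (contMDiff_legendre hL.smooth).contMDiffAt).of_eq hleg
        have h3 := hc.comp (hγ.smooth.contMDiffAt (x := q))
        refine h2.velocity_unique (h3.congr ?_)
        filter_upwards [hcS] with t ht
        exact legendre_beta hL hξsol hproj (hγ.mem_final _ ht)
    -- The SODE condition: `β_ξ ∘ γ_f = X^γ` is a section of `τ_Q` over `Q_f`, so `Tτ_Q` returns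
    -- `X^γ(q)`, which is the base point in `TQ`.
    · have h2 := h1.comp (contMDiff_tauQ.contMDiffAt (x := beta L k ξ (toCB γ q)))
      have h3 : tauQ (beta L k ξ (toCB γ q)) = q := by rw [hβγ q hq]; rfl
      have h4 := (h2.of_eq h3).velocity_unique (hc.congr (by
        filter_upwards [hcS] with t ht
        simp only [Function.comp_apply]
        rw [hβγ _ ht]
        rfl))
      have h5 : ∀ w : TB E Q, w = ⟨q, fieldGamma X γ q⟩ → (w.snd : E) = fieldGamma X γ q := by
        rintro w rfl; rfl
      exact h4.trans (h5 _ (hβγ q hq)).symm
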